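/- Let $\mathcal H$ be a finite-dimensional real inner product space with induced norm $\|\cdot\|$. For $f:\mathcal H\to(-\infty,\infty]$ and $\varepsilon\ge 0$ let $\partial_\varepsilon f(x)=\{u: f(w)\ge f(x)+\langle u,w-x\rangle-\varepsilon\ \ \forall w\in\mathcal H\}$ and $\partial f=\partial_0 f$. **Problem.** Let $f,g:\mathcal H\to(-\infty,\infty]$ be proper, closed and convex, $h:=f+g$ with $\operatorname{dom} h\ne\emptyset$, and let $g$ be $\mu$-strongly convex, $\mu>0$. Let $\Omega$ be a closed convex set containing $\{x:\partial f(x)\neq\emptyset\}$ and $P_\Omega$ the orthogonal projection onto it. Let $p\ge 2$ be an integer and let $g$ be $p$ times continuously differentiable on $\Omega$ (finite and $C^p$ around each point of $\Omega$) with $\|D^pg(x)-D^pg(y)\|\le L_p\|x-y\|$ for all $x,y\in\Omega$, where $0<L_p<\infty$. Let $M>0$ with $M\ge pL_p$ and $$g_{z,p}(y)=g(z)+\sum_{k=1}^p\frac1{k!}D^kg(z)[y-z]^k+\frac{M}{(p+1)!}\|y-z\|^{p+1}.$$ **Approximate solutions.** Given $\hat\sigma\ge0$, a triple $(y,u,\varepsilon)\in\mathcal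 H\times\mathcal H\times\mathbb R_+$ is a $\hat\sigma$-approximate Tensor solution at $(x,\lambda)$, $\lambda>0$, if $u\in\partial_\varepsilon f(y)$ and, with $z=P_\Omega(x)$, $$\frac{\|\lambda(u+\nabla g_{z,p}(y))+y-x\|^2}{1+\lambda\mu}+2\lambda\varepsilon\le\hat\sigma^2\|y-x\|^2 .$$ **Algorithm.** Choose $x^0,y^0\in\mathcal H$, $\hat\sigma\ge0$ and $0<\sigma_\ell<\sigma_u<1$ with $\sigma:=\sigma_u+\hat\sigma<1$ and $\sigma_\ell(1+\hat\sigma)^{p-1}<\sigma_u(1-\hat\sigma)^{p-1}$; set $A_0=0$. For $k=0,1,2,\dots$ compute $\lambda_{k+1}>0$ and a $\hat\sigma$-approximate Tensor solution $(y^{k+1},u^{k+1},\varepsilon_{k+1})$ at $(\widetilde x^k,\lambda_{k+1})$ with $$\frac{p!\,\sigma_\ell}{L_p+M}\le\lambda_{k+1}\|y^{k+1}-\widetilde x^k\|^{p-1}\le\frac{p!\,\sigma_u\sqrt{1+\lambda_{k+1}\mu}}{L_p+M},$$ where $$\widetilde x^k=\frac{a_{k+1}-\mu A_k\lambda_{k+1}}{A_k+a_{k+1}}x^k+\frac{A_k+\mu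 A_k\lambda_{k+1}}{A_k+a_{k+1}}y^k,$$ $$a_{k+1}=\frac{(1+2\mu A_k)\lambda_{k+1}+\sqrt{(1+2\mu A_k)^2\lambda_{k+1}^2+4(1+\mu A_k)A_k\lambda_{k+1}}}{2},$$ and put $A_{k+1}=A_k+a_{k+1}$, $v^{k+1}=u^{k+1}+\nabla g(y^{k+1})$ and $$x^{k+1}=\frac{1+\mu A_k}{1+\mu A_{k+1}}x^k+\frac{\mu a_{k+1}}{1+\mu A_{k+1}}y^{k+1}-\frac{a_{k+1}}{1+\mu A_{k+1}}v^{k+1}.$$ **Theorem.** Consider (infinite) sequences generated by the algorithm. Then $h$ has a unique minimizer $x^*$, and with $d_0:=\|x^0-x^*\|$, $\theta:=\frac{p!\,\sigma_\ell}{L_p+M}$, $C:=\lambda_1^{\frac{p-1}{p+1}}\theta^{\frac2{p+1}}(1-\sigma^2)^{\frac{p-1}{p+1}}$ and $G(s):=1+\frac{2\mu C}{d_0^{2(p-1)/(p+1)}}\,s^{\frac{p-1}{p+1}}$, one has $d_0>0$ and the following. (a) For all $k\ge0$, $$h(y^{k+1})-h(x^*)\le\frac{d_0^2}{2\lambda_1G(k)^k},\qquad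 \max\{\|x^*-x^{k+1}\|^2,\|x^*-y^{k+1}\|^2\}\le\frac{d_0^2}{\mu\lambda_1G(k)^k}.$$ (b) For all $k\ge1$, $v^{k+1}\in\partial_{\varepsilon_{k+1}}f(y^{k+1})+\partial g(y^{k+1})$ and $$\|v^{k+1}\|^2\le\Big(1+\sigma\sqrt{1+\mu C d_0^{-\frac{2(p-1)}{p+1}}}\Big)^2\frac{6\,d_0^{\frac{2(3p-1)}{p+1}}}{\mu C^2\lambda_1G(k-1)^{k-1}},\qquad \varepsilon_{k+1}\le\frac{3\sigma^2d_0^{\frac{4p}{p+1}}}{\mu C\lambda_1G(k-1)^{k-1}} .$$ (c) As $k\to\infty$, $h(y^{k+1})-h(x^*)$ and $\max\{\|x^*-x^{k+1}\|^2,\|x^*-y^{k+1}\|^2\}$ are $\mathcal O\big(1/k^{k\frac{p-1}{p+1}}\big)$, and $\|v^{k+1}\|^2$ and $\varepsilon_{k+1}$ are $\mathcal O\big(1/(k-1)^{(k-1)\frac{p-1}{p+1}}\big)$. -/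

import Mathlib

open Filter Asymptotics Topology
open scoped Pointwise

noncomputable section

namespace TensorMethod

variable {H : Type*} [NormedAddCommGroup H] [InnerProductSpace ℝ H]

/-- A function with values in `(-∞, ∞]` that is not identically `+∞`. -/
def IsProper (f : H → EReal) : Prop :=
  (∀ x, f x ≠ ⊥) ∧ ∃ x, f x ≠ ⊤

/-- Convexity of an extended-real-valued function (with `0 * ∞ = 0`). -/
def IsConvexFn (f : H → EReal) : Prop :=
  ∀ x y : H, ∀ t : ℝ, 0 ≤ t → t ≤ 1 →
    f (t • x + (1 - t) • y) ≤ (t : EReal) * f x + ((1 - t : ℝ) : EReal) * f y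

/-- `μ`-strong convexity of an extended-real-valued function. -/
def IsStronglyConvexFn (μ : ℝ) (g : H → EReal) : Prop :=
  0 < μ ∧ ∀ x y : H, ∀ t : ℝ, 0 ≤ t → t ≤ 1 →
    g (t • x + (1 - t) • y) ≤
      (t : EReal) * g x + ((1 - t : ℝ) : EReal) * g y
        - ((1 / 2 * μ * t * (1 - t) * ‖x - y‖ ^ 2 : ℝ) : EReal)

/-- The `ε`-subdifferential `∂_ε f (x)`. -/
def epsSubdiff (f : H → EReal) (ε : ℝ) (x : H) : Set H :=
  {u | ∀ y : H, f x + ((inner ℝ u (y - x) - ε : ℝ) : EReal) ≤ f y}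

/-- The subdifferential `∂ f (x) = ∂_0 f (x)`. -/
def subdiff (f : H → EReal) (x : H) : Set H := epsSubdiff f 0 x

/-- The set `Dom (∂ f)` of the points with a nonempty subdifferential. -/
def domSubdiff (f : H → EReal) : Set H := {x | (subdiff f x).Nonempty}

/-- The real-valued representative of `g`; it is used only near points where `g` is finite. -/
def realPart (g : H → EReal) : H → ℝ := fun x => (g x).toReal

/-- `g` is `p` times continuously differentiable on `Ω`: around each point of `Ω` it is
finite and of class `C^p`. -/
def IsCpOn (p : ℕ) (g : H → EReal) (Ω : Set H) : Prop :=
  ∀ x ∈ Ω, (∀ᶠ y in 𝓝 x, g y ≠ ⊤) ∧ ContDiffAt ℝ p (realPart g) x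

/-- `x` is a global minimizer of `f + g`. -/
def IsSolution (f g : H → EReal) (x : H) : Prop :=
  ∀ w : H, f x + g x ≤ f w + g w

/-- The standing assumptions on the problem `min f + g`. -/
structure IsTensorProblem (f g : H → EReal) (Ω : Set H) (μ : ℝ) (p : ℕ) (L : ℝ) : Prop where
  proper_f : IsProper f
  closed_f : LowerSemicontinuous f
  convex_f : IsConvexFn f
  proper_g : IsProper g
  closed_g : LowerSemicontinuous g
  strong_g : IsStronglyConvexFn μ g
  dom_sum : ∃ x, f x + g x ≠ ⊤
  closed_dom : IsClosed Ω
  convex_dom : Convex ℝ Ω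
  dom_subset : domSubdiff f ⊆ Ω
  two_le : 2 ≤ p
  smooth_g : IsCpOn p g Ω
  L_pos : 0 < L
  lipschitz : ∀ x ∈ Ω, ∀ y ∈ Ω,
    ‖iteratedFDeriv ℝ p (realPart g) x - iteratedFDeriv ℝ p (realPart g) y‖ ≤ L * ‖x - y‖

/-- The regularized Taylor model
`g_{z,p}(y) = g(z) + ∑_{k=1}^p D^k g(z)[y - z]^k / k! + M / (p+1)! * ‖y - z‖^(p+1)`. -/
def tensorModel (g : H → EReal) (p : ℕ) (M : ℝ) (z y : H) : ℝ :=
  realPart g z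
    + ∑ k ∈ Finset.Icc 1 p,
        (1 / (k.factorial : ℝ)) * iteratedFDeriv ℝ k (realPart g) z (fun _ => y - z)
    + M / ((p + 1).factorial : ℝ) * ‖y - z‖ ^ (p + 1)

/-- `z` is the metric projection of `x` onto `Ω`. -/
def IsMetricProj (Ω : Set H) (x z : H) : Prop :=
  z ∈ Ω ∧ ∀ w ∈ Ω, ‖x - z‖ ≤ ‖x - w‖

/-- `(y, u, ε)` is a `σhat`-approximate Tensor solution at `(x, lam)` of the inclusion
`0 ∈ lam (∂ f (y) + ∇ g_{z,p}(y)) + y - x` with `z` the projection of `x` onto `Ω`. -/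
def IsApproxTensorSolution [CompleteSpace H] (f g : H → EReal) (Ω : Set H) (μ : ℝ) (p : ℕ)
    (M σhat : ℝ) (x : H) (lam : ℝ) (y u : H) (ε : ℝ) : Prop :=
  0 ≤ σhat ∧ 0 < lam ∧ 0 ≤ ε ∧ u ∈ epsSubdiff f ε y ∧
    ∃ z : H, IsMetricProj Ω x z ∧
      ‖lam • (u + gradient (tensorModel g p M z) y) + y - x‖ ^ 2 / (1 + lam * μ) + 2 * lam * ε
        ≤ σhat ^ 2 * ‖y - x‖ ^ 2

/-- The sequences are generated by the accelerated inexact `p`-th order tensor method. The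
entries of index `0` of `u`, `v`, `lam`, `a`, `ε` are not used. -/
structure IsTensorRun [CompleteSpace H] (f g : H → EReal) (Ω : Set H) (μ : ℝ) (p : ℕ)
    (L M σhat σl σu : ℝ) (x y xt u v : ℕ → H) (lam a A ε : ℕ → ℝ) : Prop where
  σhat_nonneg : 0 ≤ σhat
  σl_pos : 0 < σl
  σl_lt : σl < σu
  σu_lt : σu < 1
  σ_lt : σu + σhat < 1
  σ_cond : σl * (1 + σhat) ^ (p - 1) < σu * (1 - σhat) ^ (p - 1)
  A_zero : A 0 = 0
  lam_pos : ∀ k, 0 < lam (k + 1)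
  approx : ∀ k, IsApproxTensorSolution f g Ω μ p M σhat (xt k) (lam (k + 1))
    (y (k + 1)) (u (k + 1)) (ε (k + 1))
  step_lower : ∀ k, (p.factorial : ℝ) * σl / (L + M) ≤
    lam (k + 1) * ‖y (k + 1) - xt k‖ ^ (p - 1)
  step_upper : ∀ k, lam (k + 1) * ‖y (k + 1) - xt k‖ ^ (p - 1) ≤
    (p.factorial : ℝ) * σu * √(1 + lam (k + 1) * μ) / (L + M)
  xt_eq : ∀ k, xt k =
    ((a (k + 1) - μ * A k * lam (k + 1)) / (A k + a (k + 1))) • x k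
      + ((A k + μ * A k * lam (k + 1)) / (A k + a (k + 1))) • y k
  a_eq : ∀ k, a (k + 1) =
    ((1 + 2 * μ * A k) * lam (k + 1)
      + √((1 + 2 * μ * A k) ^ 2 * lam (k + 1) ^ 2
          + 4 * (1 + μ * A k) * A k * lam (k + 1))) / 2
  A_eq : ∀ k, A (k + 1) = A k + a (k + 1)
  v_eq : ∀ k, v (k + 1) = u (k + 1) + gradient (realPart g) (y (k + 1))
  x_eq : ∀ k, x (k + 1) =
    ((1 + μ * A k) / (1 + μ * A (k + 1))) • x k
      + (μ * a (k + 1) / (1 + μ * A (k + 1))) • y (k + 1)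
      - (a (k + 1) / (1 + μ * A (k + 1))) • v (k + 1)

/-- The objective `h = f + g`. -/
def objective (f g : H → EReal) (x : H) : EReal := f x + g x

/-- The factor `(1 + (2 μ C / d₀^(2(p-1)/(p+1))) s^((p-1)/(p+1)))`. -/
def growth (μ C d₀ : ℝ) (p : ℕ) (s : ℝ) : ℝ :=
  1 + 2 * μ * C / d₀ ^ (2 * ((p : ℝ) - 1) / ((p : ℝ) + 1))
    * s ^ (((p : ℝ) - 1) / ((p : ℝ) + 1))

/-- The comparison function `1 / s^(s (p-1)/(p+1))`. -/
def superRate (p : ℕ) (s : ℝ) : ℝ :=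
  1 / s ^ (s * (((p : ℝ) - 1) / ((p : ℝ) + 1)))

end TensorMethod

end

/-!
The proof has three layers.

*Reduction to a hybrid proximal extragradient method.* Effective domains are controlled first: by
proximal points, `dom f ⊆ closure (dom ∂f) ⊆ Ω` (`mem_closure_domSubdiff`), so every `y (k + 1)`
lies in `Ω` even though `u (k + 1)` is only an `ε`-subgradient. Taylor's formula along the segment
from the projection `z` to `y` gives
`‖∇g y - ∇g_{z,p} y‖ ≤ (L + M) / p! * ‖y - z‖ ^ p` (`norm_gradient_tensorModel_sub_le`), and the
projection does not increase distances to `Ω`. With the upper large-step bound, the model gradient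
can therefore be replaced by `∇g` at the price of increasing the relative error from `σhat` to
`σ = σu + σhat` (`IsTensorRun.residual`).

*Energy estimate.* Strong convexity makes
`h (y (k + 1)) + ⟪v (k + 1), · - y (k + 1)⟫ + μ / 2 * ‖· - y (k + 1)‖ ^ 2 - ε (k + 1)` a minorant of
`h = f + g`. The quadratic equation satisfied by `a (k + 1)` is exactly what makes the energy
`A k * (h (y k) - h x*) + (1 + μ * A k) / 2 * ‖x* - x k‖ ^ 2` decrease in each step by at least
`(1 - σ ^ 2) / 2 * A (k + 1) / lam (k + 1) * ‖y (k + 1) - xt k‖ ^ 2` (`energy_step`). Hence function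
values and errors are `O (1 / A)`, residuals are bounded by displacements, which are again
`O (1 / A)`, and `d₀ > 0` since the first displacement does not vanish.

*Growth of `A`.* The summed decrease and the lower large-step bound give, for the constant
`D = C / d₀ ^ (2 (p - 1) / (p + 1))` and the exponent `q = (p + 1) / (p - 1)`, the estimate
`∑ A (j + 1) / lam 1 * (D / lam (j + 1)) ^ q ≤ 1` (`IsTensorRun.rate_sum_le`), while
`A (k + 1) ≥ (1 + 2 * μ * lam (k + 1)) * A k`. Bounding the weights below by `1`, convexity of
`s ↦ log (1 + c * exp s)` turns this into `A (k + 1) ≥ lam 1 * G k ^ k` (`growth_le_aggregated`),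
which yields the explicit bounds. These do not imply the stated superlinear rates: they
only give them up to the factor `(2 * μ * D) ^ (-k)`, which is unbounded if `2 * μ * D < 1`.
Keeping the weights, one has
`lam (k + 1) ≥ D * (A (k + 1) / lam 1) ^ (1 / q)`, so `lam` grows geometrically, and `A (k + 1)`
dominates a multiple of `exp k * k!`, hence of `k ^ k` (`exists_mul_pow_self_le`).
-/

namespace TensorMethod

/-! ### Taylor estimates for the tensor model -/

section Taylor

variable {E F : Type*} [NormedAddCommGroup E] [NormedSpace ℝ E]
  [NormedAddCommGroup F] [NormedSpace ℝ F]

/-- The first two arguments of an iterated derivative may be exchanged. -/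
theorem iteratedFDeriv_cons_cons_comm {f : E → F} {x : E} {k : ℕ}
    (hf : ContDiffAt ℝ ((k + 2 : ℕ) : WithTop ℕ∞) f x) (a b : E) (m : Fin k → E) :
    iteratedFDeriv ℝ (k + 2) f x (Fin.cons a (Fin.cons b m)) =
      iteratedFDeriv ℝ (k + 2) f x (Fin.cons b (Fin.cons a m)) := by
  have hk : ContDiffAt ℝ 2 (iteratedFDeriv ℝ k f) x := by
    refine hf.iteratedFDeriv_right (m := 2) (i := k) ?_
    push_cast
    rw [add_comm]
  have hsymm : IsSymmSndFDerivAt ℝ (iteratedFDeriv ℝ k f) x :=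
    hk.isSymmSndFDerivAt (by simp)
  have hd : DifferentiableAt ℝ (iteratedFDeriv ℝ (k + 1) f) x :=
    hf.differentiableAt_iteratedFDeriv (by exact_mod_cast Nat.lt_succ_self _)
  have hd2 : DifferentiableAt ℝ (fderiv ℝ (iteratedFDeriv ℝ k f)) x :=
    (hk.fderiv_right (m := 1) (by norm_num)).differentiableAt (by norm_num)
  have key : ∀ a b : E, iteratedFDeriv ℝ (k + 2) f x (Fin.cons a (Fin.cons b m)) =
      fderiv ℝ (fderiv ℝ (iteratedFDeriv ℝ k f)) x a b m := by
    intro a b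
    rw [iteratedFDeriv_succ_apply_left]
    simp only [Fin.cons_zero, Fin.tail_cons]
    have h1 : HasFDerivAt (fun y => iteratedFDeriv ℝ (k + 1) f y (Fin.cons b m))
        ((ContinuousMultilinearMap.apply ℝ (fun _ : Fin (k + 1) => E) F (Fin.cons b m)).comp
          (fderiv ℝ (iteratedFDeriv ℝ (k + 1) f) x)) x :=
      (ContinuousMultilinearMap.apply ℝ (fun _ : Fin (k + 1) => E) F
        (Fin.cons b m)).hasFDerivAt.comp x hd.hasFDerivAt
    have h2 : HasFDerivAt (fun y => fderiv ℝ (iteratedFDeriv ℝ k f) y b m)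
        (((ContinuousMultilinearMap.apply ℝ (fun _ : Fin k => E) F m).comp
          (ContinuousLinearMap.apply ℝ _ b)).comp
          (fderiv ℝ (fderiv ℝ (iteratedFDeriv ℝ k f)) x)) x :=
      HasFDerivAt.comp x (g := ((ContinuousMultilinearMap.apply ℝ (fun _ : Fin k => E) F m).comp
        (ContinuousLinearMap.apply ℝ _ b))) (ContinuousLinearMap.hasFDerivAt _) hd2.hasFDerivAt
    have h3 : (fun y => iteratedFDeriv ℝ (k + 1) f y (Fin.cons b m)) =
        fun y => fderiv ℝ (iteratedFDeriv ℝ k f) y b m := by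
      funext y
      rw [iteratedFDeriv_succ_apply_left]
      simp
    rw [h3] at h1
    have := DFunLike.congr_fun (h1.unique h2) a
    simpa using this
  rw [key, key, hsymm.eq]

/-- If all arguments of an iterated derivative but one agree, the position of the exceptional
argument is irrelevant. -/
theorem iteratedFDeriv_update_const {f : E → F} (d e : E) (n : ℕ) :
    ∀ x : E, ContDiffAt ℝ (n : WithTop ℕ∞) f x → ∀ i j : Fin n,
      iteratedFDeriv ℝ n f x (Function.update (fun _ => d) i e) =
        iteratedFDeriv ℝ n f x (Function.update (fun _ => d) j e) := by
  induction n with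
  | zero => intro x _ i; exact i.elim0
  | succ n ih =>
    intro x hf
    have hd : DifferentiableAt ℝ (iteratedFDeriv ℝ n f) x :=
      hf.differentiableAt_iteratedFDeriv (by exact_mod_cast Nat.lt_succ_self _)
    have hnear : ∀ᶠ y in 𝓝 x, ContDiffAt ℝ (n : WithTop ℕ∞) f y :=
      (hf.of_le (by exact_mod_cast Nat.le_succ n)).eventually (by simp)
    have hsucc : ∀ i j : Fin n,
        iteratedFDeriv ℝ (n + 1) f x (Function.update (fun _ => d) i.succ e) =
          iteratedFDeriv ℝ (n + 1) f x (Function.update (fun _ => d) j.succ e) := by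
      have hder : ∀ m : Fin n → E, HasFDerivAt (fun y => iteratedFDeriv ℝ n f y m)
          ((ContinuousMultilinearMap.apply ℝ (fun _ : Fin n => E) F m).comp
            (fderiv ℝ (iteratedFDeriv ℝ n f) x)) x := fun m =>
        (ContinuousMultilinearMap.apply ℝ (fun _ : Fin n => E) F m).hasFDerivAt.comp x hd.hasFDerivAt
      have hval : ∀ i : Fin n,
          iteratedFDeriv ℝ (n + 1) f x (Function.update (fun _ => d) i.succ e) =
            fderiv ℝ (iteratedFDeriv ℝ n f) x d (Function.update (fun _ => d) i e) := by
        intro i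
        rw [iteratedFDeriv_succ_apply_left]
        have h0 : Function.update (fun _ : Fin (n + 1) => d) i.succ e 0 = d := by
          rw [Function.update_of_ne (Fin.succ_ne_zero i).symm]
        have h1 : Fin.tail (Function.update (fun _ : Fin (n + 1) => d) i.succ e) =
            Function.update (fun _ => d) i e := by
          rw [Fin.tail_update_succ]
          rfl
        rw [h0, h1]
      intro i j
      have hij : (fun y => iteratedFDeriv ℝ n f y (Function.update (fun _ => d) i e)) =ᶠ[𝓝 x]
          fun y => iteratedFDeriv ℝ n f y (Function.update (fun _ => d) j e) :=
        hnear.mono fun y hy => ih y hy i j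
      have := DFunLike.congr_fun (((hder _).congr_of_eventuallyEq hij.symm).unique (hder _)) d
      rw [hval, hval]
      simpa using this
    have hzero : ∀ j : Fin n,
        iteratedFDeriv ℝ (n + 1) f x (Function.update (fun _ => d) 0 e) =
          iteratedFDeriv ℝ (n + 1) f x (Function.update (fun _ => d) j.succ e) := by
      intro j
      obtain ⟨k, rfl⟩ : ∃ k, n = k + 1 := ⟨n - 1, by have := j.pos; omega⟩
      rw [hsucc j 0]
      have hu0 : Function.update (fun _ : Fin (k + 1 + 1) => d) 0 e =
          Fin.cons e (Fin.cons d fun _ => d) := by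
        funext l
        refine Fin.cases ?_ (fun l => ?_) l
        · simp
        · rw [Function.update_of_ne (Fin.succ_ne_zero l), Fin.cons_succ]
          refine Fin.cases ?_ (fun l => ?_) l <;> simp
      have hu1 : Function.update (fun _ : Fin (k + 1 + 1) => d) (Fin.succ 0) e =
          Fin.cons d (Fin.cons e fun _ => d) := by
        funext l
        refine Fin.cases ?_ (fun l => ?_) l
        · rw [Function.update_of_ne (Fin.succ_ne_zero _).symm, Fin.cons_zero]
        · rw [Fin.cons_succ]
          refine Fin.cases ?_ (fun l => ?_) l
          · simp
          · rw [Function.update_of_ne (by simp [Fin.ext_iff]), Fin.cons_succ]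
      rw [hu0, hu1]
      exact iteratedFDeriv_cons_cons_comm hf e d _
    intro i j
    refine Fin.cases ?_ (fun i => ?_) i <;> refine Fin.cases ?_ (fun j => ?_) j
    · rfl
    · exact hzero j
    · exact (hzero i).symm
    · exact hsucc i j

/-- The derivative of a homogeneous Taylor term, by the symmetry of the iterated derivative. -/
theorem hasFDerivAt_iteratedFDeriv_diag {f : E → F} {z : E} {k : ℕ}
    (hf : ContDiffAt ℝ ((k + 1 : ℕ) : WithTop ℕ∞) f z) (y : E) :
    HasFDerivAt (fun y => iteratedFDeriv ℝ (k + 1) f z (fun _ => y - z))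
      (((k : ℝ) + 1) • iteratedFDeriv ℝ k (fderiv ℝ f) z (fun _ => y - z)) y := by
  have h := HasFDerivAt.multilinear_comp (iteratedFDeriv ℝ (k + 1) f z)
    (g := fun _ y => y - z) (g' := fun _ => ContinuousLinearMap.id ℝ E) (x := y)
    (fun _ => (hasFDerivAt_id y).sub_const z)
  convert h using 1
  ext w
  have hterm : ∀ i : Fin (k + 1),
      iteratedFDeriv ℝ (k + 1) f z (Function.update (fun _ => y - z) i w) =
        iteratedFDeriv ℝ k (fderiv ℝ f) z (fun _ => y - z) w := by
    intro i
    rw [iteratedFDeriv_update_const (y - z) w (k + 1) z hf i (Fin.last k),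
      iteratedFDeriv_succ_apply_right]
    simp [Fin.init_update_last]
    rfl
  have hsum : ∑ i : Fin (k + 1), (iteratedFDeriv ℝ (k + 1) f z).toContinuousLinearMap
      (fun _ => y - z) i w = ((k : ℝ) + 1) •
        iteratedFDeriv ℝ k (fderiv ℝ f) z (fun _ => y - z) w := by
    refine (Finset.sum_congr rfl fun i _ => hterm i).trans ?_
    rw [Finset.sum_const, Finset.card_univ,
      Fintype.card_fin, ← Nat.cast_smul_eq_nsmul ℝ, Nat.cast_succ]
  simpa using hsum.symm

/-- Taylor's formula on `[0, 1]` for a curve whose `n`-th derivative is Lipschitz at `0`. -/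
theorem norm_sub_taylor_le_of_lipschitz {K : ℝ} (n : ℕ) :
    ∀ φ : ℕ → ℝ → F,
      (∀ j < n, ∀ t ∈ Set.Icc (0 : ℝ) 1, HasDerivAt (φ j) (φ (j + 1) t) t) →
      (∀ t ∈ Set.Icc (0 : ℝ) 1, ‖φ n t - φ n 0‖ ≤ K * t) →
      ∀ t ∈ Set.Icc (0 : ℝ) 1,
        ‖φ 0 t - ∑ j ∈ Finset.range (n + 1), (t ^ j / (j.factorial : ℝ)) • φ j 0‖ ≤
          K * (t ^ (n + 1) / ((n + 1).factorial : ℝ)) := by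
  induction n with
  | zero => intro φ _ h t ht; simpa using h t ht
  | succ n ih =>
    intro φ hφ hK
    have hpow : ∀ (j : ℕ) (t : ℝ), HasDerivAt (fun t : ℝ => t ^ (j + 1) / ((j + 1).factorial : ℝ))
        (t ^ j / (j.factorial : ℝ)) t := by
      intro j t
      refine ((hasDerivAt_pow (j + 1) t).div_const ((j + 1).factorial : ℝ)).congr_deriv ?_
      have h1 : (j.factorial : ℝ) ≠ 0 := by positivity
      have h2 : ((j + 1).factorial : ℝ) = ((j : ℝ) + 1) * j.factorial := by
        rw [Nat.factorial_succ]; push_cast; ring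
      rw [h2]
      push_cast
      field_simp
    have ih' := ih (fun j => φ (j + 1)) (fun j hj => hφ (j + 1) (by omega)) hK
    have hder : ∀ t ∈ Set.Icc (0 : ℝ) 1, HasDerivAt
        (fun t => φ 0 t - ∑ j ∈ Finset.range (n + 1 + 1), (t ^ j / (j.factorial : ℝ)) • φ j 0)
        (φ 1 t - ∑ j ∈ Finset.range (n + 1), (t ^ j / (j.factorial : ℝ)) • φ (j + 1) 0) t := by
      intro t ht
      refine (hφ 0 (by omega) t ht).sub ?_
      simp only [Finset.sum_range_succ' _ (n + 1), pow_zero]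
      refine HasDerivAt.add_const _ ?_
      exact HasDerivAt.fun_sum fun j _ => (hpow j t).smul_const _
    refine image_norm_le_of_norm_deriv_right_le_deriv_boundary
      (f' := fun t => φ 1 t - ∑ j ∈ Finset.range (n + 1), (t ^ j / (j.factorial : ℝ)) • φ (j + 1) 0)
      (B' := fun t => K * (t ^ (n + 1) / ((n + 1).factorial : ℝ)))
      (fun t ht => (hder t ht).continuousAt.continuousWithinAt)
      (fun t ht => (hder t ⟨ht.1, ht.2.le⟩).hasDerivWithinAt) ?_
      (fun t => (hpow (n + 1) t).const_mul K)
      (fun t ht => ih' t ⟨ht.1, ht.2.le⟩)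
    simp [Finset.sum_range_succ' _ (n + 1)]

/-- First-order Taylor estimate for the derivative, with a Lipschitz `p`-th derivative on the
segment. -/
theorem norm_fderiv_sub_taylor_le {f : E → F} {p : ℕ} {L : ℝ} (z d : E)
    (hf : ∀ t ∈ Set.Icc (0 : ℝ) 1, ContDiffAt ℝ ((p + 1 : ℕ) : WithTop ℕ∞) f (z + t • d))
    (hL : ∀ t ∈ Set.Icc (0 : ℝ) 1,
      ‖iteratedFDeriv ℝ (p + 1) f (z + t • d) - iteratedFDeriv ℝ (p + 1) f z‖ ≤ L * (t * ‖d‖)) :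
    ‖fderiv ℝ f (z + d) - ∑ j ∈ Finset.range (p + 1),
        (1 / (j.factorial : ℝ)) • iteratedFDeriv ℝ j (fderiv ℝ f) z (fun _ => d)‖ ≤
      L / ((p + 1).factorial : ℝ) * ‖d‖ ^ (p + 1) := by
  have hder : ∀ j < p, ∀ t ∈ Set.Icc (0 : ℝ) 1,
      HasDerivAt (fun t : ℝ => iteratedFDeriv ℝ j (fderiv ℝ f) (z + t • d) (fun _ => d))
        (iteratedFDeriv ℝ (j + 1) (fderiv ℝ f) (z + t • d) (fun _ => d)) t := by
    intro j hj t ht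
    have hC : ContDiffAt ℝ (p : WithTop ℕ∞) (fderiv ℝ f) (z + t • d) :=
      (hf t ht).fderiv_right (by push_cast; exact le_rfl)
    have hd : DifferentiableAt ℝ (iteratedFDeriv ℝ j (fderiv ℝ f)) (z + t • d) :=
      hC.differentiableAt_iteratedFDeriv (by exact_mod_cast hj)
    have hline : HasDerivAt (fun t : ℝ => z + t • d) d t := by
      simpa using ((hasDerivAt_id t).smul_const d).const_add z
    have h1 := hd.hasFDerivAt.comp_hasDerivAt t hline
    have h2 := (ContinuousMultilinearMap.apply ℝ (fun _ : Fin j => E) (E →L[ℝ] F)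
      (fun _ => d)).hasFDerivAt.comp_hasDerivAt t h1
    rw [iteratedFDeriv_succ_apply_left]
    exact h2
  have hLip : ∀ t ∈ Set.Icc (0 : ℝ) 1,
      ‖iteratedFDeriv ℝ p (fderiv ℝ f) (z + t • d) (fun _ => d) -
        iteratedFDeriv ℝ p (fderiv ℝ f) (z + (0 : ℝ) • d) (fun _ => d)‖ ≤
          (L * ‖d‖ ^ (p + 1)) * t := by
    intro t ht
    have hiso : ‖iteratedFDeriv ℝ p (fderiv ℝ f) (z + t • d) -
        iteratedFDeriv ℝ p (fderiv ℝ f) z‖ ≤ L * (t * ‖d‖) := by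
      have := hL t ht
      rwa [iteratedFDeriv_succ_eq_comp_right, iteratedFDeriv_succ_eq_comp_right,
        Function.comp_apply, Function.comp_apply,
        ← LinearIsometryEquiv.map_sub, LinearIsometryEquiv.norm_map] at this
    rw [zero_smul, add_zero, ← sub_apply]
    refine (ContinuousMultilinearMap.le_opNorm _ _).trans ?_
    rw [Finset.prod_const, Finset.card_univ, Fintype.card_fin]
    calc _ ≤ L * (t * ‖d‖) * ‖d‖ ^ p := by gcongr
      _ = _ := by ring
  have := norm_sub_taylor_le_of_lipschitz p
    (fun j t => iteratedFDeriv ℝ j (fderiv ℝ f) (z + t • d) (fun _ => d)) hder hLip 1 (by simp)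
  simp only [one_pow, one_smul, zero_smul, add_zero] at this
  calc _ = _ := by
        congr 1
    _ ≤ _ := this
    _ = _ := by ring

end Taylor

variable {H : Type*} [NormedAddCommGroup H] [InnerProductSpace ℝ H]

/-- The gradient of the regularized Taylor model approximates the gradient of `g`. -/
theorem norm_gradient_tensorModel_sub_le [CompleteSpace H] {g : H → EReal} {Ω : Set H} {p : ℕ}
    {L M : ℝ} (hΩ : Convex ℝ Ω) (hp : 1 ≤ p) (hM : 0 ≤ M) (hg : IsCpOn p g Ω)
    (hL : ∀ x ∈ Ω, ∀ y ∈ Ω,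
      ‖iteratedFDeriv ℝ p (realPart g) x - iteratedFDeriv ℝ p (realPart g) y‖ ≤ L * ‖x - y‖)
    {z y : H} (hz : z ∈ Ω) (hy : y ∈ Ω) :
    ‖gradient (realPart g) y - gradient (tensorModel g p M z) y‖ ≤
      (L + M) / (p.factorial : ℝ) * ‖y - z‖ ^ p := by
  obtain ⟨p, rfl⟩ : ∃ q, p = q + 1 := ⟨p - 1, by omega⟩
  have hseg : ∀ t ∈ Set.Icc (0 : ℝ) 1, z + t • (y - z) ∈ Ω := fun t ht =>
    hΩ.add_smul_sub_mem hz hy ht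
  have htaylor := norm_fderiv_sub_taylor_le (f := realPart g) (L := L) (p := p) z (y - z)
    (fun t ht => (hg _ (hseg t ht)).2) (fun t ht => by
      refine (hL _ (hseg t ht) z hz).trans_eq ?_
      rw [add_sub_cancel_left, norm_smul, Real.norm_of_nonneg ht.1])
  rw [add_sub_cancel] at htaylor
  have hnorm : HasFDerivAt (fun y : H => ‖y - z‖ ^ (p + 1 + 1))
      ((((p : ℝ) + 2) * ‖y - z‖ ^ p) • innerSL ℝ (y - z)) y := by
    have h1 := (hasFDerivAt_norm_rpow (y - z) (p := (p : ℝ) + 2)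
      (by have : (0 : ℝ) ≤ p := p.cast_nonneg
          linarith)).comp y ((hasFDerivAt_id y).sub_const z)
    have e1 : (fun y : H => ‖y - z‖ ^ (p + 1 + 1)) =
        (fun x : H => ‖x‖ ^ ((p : ℝ) + 2)) ∘ fun y => id y - z := by
      funext y
      simp only [Function.comp_apply, id]
      rw [← Real.rpow_natCast]
      push_cast
      ring_nf
    rw [e1]
    refine h1.congr_fderiv ?_
    rw [ContinuousLinearMap.comp_id, add_sub_cancel_right, Real.rpow_natCast]
  have hmodel : HasFDerivAt (tensorModel g (p + 1) M z)
      ((∑ j ∈ Finset.range (p + 1), (1 / (j.factorial : ℝ)) •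
          iteratedFDeriv ℝ j (fderiv ℝ (realPart g)) z (fun _ => y - z))
        + (M / ((p + 1 + 1).factorial : ℝ)) •
          ((((p : ℝ) + 2) * ‖y - z‖ ^ p) • innerSL ℝ (y - z))) y := by
    unfold tensorModel
    refine HasFDerivAt.add ?_ (hnorm.const_mul _)
    refine HasFDerivAt.const_add _ ?_
    have e2 : (fun y : H => ∑ k ∈ Finset.Icc 1 (p + 1),
        (1 / (k.factorial : ℝ)) * iteratedFDeriv ℝ k (realPart g) z (fun _ => y - z)) =
        fun y => ∑ j ∈ Finset.range (p + 1), (1 / ((j + 1).factorial : ℝ)) *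
          iteratedFDeriv ℝ (j + 1) (realPart g) z (fun _ => y - z) := by
      funext y
      rw [Finset.range_eq_Ico, Finset.sum_Ico_add' (fun k => (1 / (k.factorial : ℝ)) *
        iteratedFDeriv ℝ k (realPart g) z (fun _ => y - z)) 0 (p + 1) 1]
      rfl
    rw [e2]
    refine HasFDerivAt.fun_sum fun j hj => ?_
    have hj' : j + 1 ≤ p + 1 := by simpa using hj
    have h3 := (hasFDerivAt_iteratedFDeriv_diag
      ((hg z hz).2.of_le (by exact_mod_cast hj')) y).const_mul (1 / ((j + 1).factorial : ℝ))
    refine h3.congr_fderiv ?_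
    rw [smul_smul]
    congr 1
    rw [Nat.factorial_succ]
    push_cast
    have : (j.factorial : ℝ) ≠ 0 := by positivity
    field_simp
  unfold gradient
  rw [← map_sub, LinearIsometryEquiv.norm_map, hmodel.fderiv, ← sub_sub]
  refine (norm_sub_le _ _).trans ?_
  rw [norm_smul, norm_smul, innerSL_apply_norm, add_div L, add_mul (L / _)]
  refine add_le_add htaylor (le_of_eq ?_)
  rw [Real.norm_of_nonneg (by positivity), Real.norm_of_nonneg (by positivity),
    Nat.factorial_succ (p + 1)]
  push_cast
  have : ((p + 1).factorial : ℝ) ≠ 0 := by positivity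
  field_simp
  ring

/-- The metric projection onto a convex set does not increase the distance to points of the set. -/
theorem IsMetricProj.norm_sub_le {Ω : Set H} (hΩ : Convex ℝ Ω) {x z y : H}
    (hz : IsMetricProj Ω x z) (hy : y ∈ Ω) : ‖y - z‖ ≤ ‖y - x‖ := by
  have hinf : ‖x - z‖ = ⨅ w : Ω, ‖x - w‖ := by
    have : Nonempty Ω := ⟨⟨z, hz.1⟩⟩
    refine le_antisymm (le_ciInf fun w => hz.2 w w.2) ?_
    exact ciInf_le ⟨0, by rintro _ ⟨w, rfl⟩; exact norm_nonneg _⟩ (⟨z, hz.1⟩ : Ω)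
  have hle := (norm_eq_iInf_iff_real_inner_le_zero hΩ hz.1).1 hinf y hy
  have hexp : ‖y - x‖ ^ 2 = ‖y - z‖ ^ 2 - 2 * inner ℝ (x - z) (y - z) + ‖x - z‖ ^ 2 := by
    rw [← sub_sub_sub_cancel_right y x z, norm_sub_sq_real, real_inner_comm]
  refine le_of_sq_le_sq ?_ (norm_nonneg _)
  nlinarith [sq_nonneg ‖x - z‖]

/-! ### Convex analysis of extended-real-valued functions -/

/-- Strong convexity with modulus `μ` of a function with values in `(-∞, ∞]`, expressed through the
real values on its effective domain; `μ = 0` is convexity. -/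
def StronglyConvexOnDom (μ : ℝ) (F : H → EReal) : Prop :=
  ∀ x y : H, F x ≠ ⊤ → F y ≠ ⊤ → ∀ t : ℝ, 0 ≤ t → t ≤ 1 →
    F (t • x + (1 - t) • y) ≤ ((t * (F x).toReal + (1 - t) * (F y).toReal
      - 1 / 2 * μ * t * (1 - t) * ‖x - y‖ ^ 2 : ℝ) : EReal)

theorem IsConvexFn.stronglyConvexOnDom {f : H → EReal} (hf : IsConvexFn f)
    (hbot : ∀ x, f x ≠ ⊥) : StronglyConvexOnDom 0 f := by
  intro x y hx hy t h0 h1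
  refine (hf x y t h0 h1).trans_eq ?_
  lift f x to ℝ using ⟨hx, hbot x⟩ with a
  lift f y to ℝ using ⟨hy, hbot y⟩ with b
  simp only [EReal.toReal_coe, mul_zero, zero_mul, sub_zero]
  norm_cast

theorem IsStronglyConvexFn.stronglyConvexOnDom {μ : ℝ} {g : H → EReal}
    (hg : IsStronglyConvexFn μ g) (hbot : ∀ x, g x ≠ ⊥) : StronglyConvexOnDom μ g := by
  intro x y hx hy t h0 h1
  refine (hg.2 x y t h0 h1).trans_eq ?_
  lift g x to ℝ using ⟨hx, hbot x⟩ with a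
  lift g y to ℝ using ⟨hy, hbot y⟩ with b
  simp only [EReal.toReal_coe]
  norm_cast

theorem StronglyConvexOnDom.add {μ ν : ℝ} {f g : H → EReal} (hf : StronglyConvexOnDom μ f)
    (hg : StronglyConvexOnDom ν g) (hfb : ∀ x, f x ≠ ⊥) (hgb : ∀ x, g x ≠ ⊥) :
    StronglyConvexOnDom (μ + ν) (fun x => f x + g x) := by
  intro x y hx hy t h0 h1
  have h : ∀ x, f x + g x ≠ ⊤ → f x ≠ ⊤ ∧ g x ≠ ⊤ := fun x hx =>
    ⟨fun h => hx (by rw [h, EReal.top_add_of_ne_bot (hgb x)]),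
      fun h => hx (by rw [h, EReal.add_top_of_ne_bot (hfb x)])⟩
  obtain ⟨hfx, hgx⟩ := h x hx
  obtain ⟨hfy, hgy⟩ := h y hy
  refine (add_le_add (hf x y hfx hfy t h0 h1) (hg x y hgx hgy t h0 h1)).trans_eq ?_
  rw [EReal.toReal_add hfx (hfb x) hgx (hgb x), EReal.toReal_add hfy (hfb y) hgy (hgb y),
    ← EReal.coe_add]
  congr 1
  ring

/-- The squared distance is strongly convex, with equality in the defining inequality. -/
theorem norm_sub_sq_convexComb (x y c : H) (t : ℝ) :
    ‖t • x + (1 - t) • y - c‖ ^ 2 =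
      t * ‖x - c‖ ^ 2 + (1 - t) * ‖y - c‖ ^ 2 - t * (1 - t) * ‖x - y‖ ^ 2 := by
  have e : t • x + (1 - t) • y - c = t • (x - c) + (1 - t) • (y - c) := by module
  have e2 : x - y = (x - c) - (y - c) := by abel
  rw [e, e2, norm_add_sq_real, norm_sub_sq_real (x - c) (y - c), norm_smul, norm_smul,
    inner_smul_left, inner_smul_right, mul_pow, mul_pow, Real.norm_eq_abs, Real.norm_eq_abs,
    sq_abs, sq_abs]
  simp only [conj_trivial]
  ring

theorem stronglyConvexOnDom_sq (c : H) (r : ℝ) :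
    StronglyConvexOnDom r (fun x => ((r / 2 * ‖x - c‖ ^ 2 : ℝ) : EReal)) := by
  intro x y _ _ t _ _
  simp only [EReal.toReal_coe, EReal.coe_le_coe_iff]
  rw [norm_sub_sq_convexComb]
  apply le_of_eq
  ring

theorem lowerSemicontinuous_add_of_ne_bot {X : Type*} [TopologicalSpace X]
    {f g : X → EReal} (hf : LowerSemicontinuous f)
    (hg : LowerSemicontinuous g) (hfb : ∀ x, f x ≠ ⊥) (hgb : ∀ x, g x ≠ ⊥) :
    LowerSemicontinuous fun x => f x + g x :=
  hf.add' hg fun x => EReal.continuousAt_add (.inr (hgb x)) (.inl (hfb x))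

/-- Quadratic growth around a minimizer. -/
theorem StronglyConvexOnDom.growth_of_isMin {μ : ℝ} {F : H → EReal}
    (hF : StronglyConvexOnDom μ F) (hbot : ∀ x, F x ≠ ⊥) {xs w : H} (hmin : ∀ w, F xs ≤ F w)
    (hw : F w ≠ ⊤) : (F xs).toReal + μ / 2 * ‖w - xs‖ ^ 2 ≤ (F w).toReal := by
  have hxs : F xs ≠ ⊤ := fun h => hw (top_le_iff.1 (h ▸ hmin w))
  have hineq : ∀ t : ℝ, 0 < t → t < 1 →
      μ / 2 * (1 - t) * ‖w - xs‖ ^ 2 ≤ (F w).toReal - (F xs).toReal := by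
    intro t h0 h1
    have h := (hmin _).trans (hF w xs hw hxs t h0.le h1.le)
    rw [← EReal.coe_toReal hxs (hbot xs), EReal.coe_le_coe_iff, EReal.toReal_coe] at h
    refine le_of_mul_le_mul_left ?_ h0
    linarith
  have hlim : Tendsto (fun t : ℝ => μ / 2 * (1 - t) * ‖w - xs‖ ^ 2) (𝓝[>] 0)
      (𝓝 (μ / 2 * (1 - 0) * ‖w - xs‖ ^ 2)) :=
    (Continuous.tendsto (by fun_prop) 0).mono_left nhdsWithin_le_nhds
  have := le_of_tendsto hlim (by
    filter_upwards [Ioo_mem_nhdsGT (zero_lt_one (α := ℝ))] with t ht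
    exact hineq t ht.1 ht.2)
  linarith

/-- A lower semicontinuous strongly convex function on a finite-dimensional space attains its
minimum: by strong convexity it exceeds its value at a base point outside a large ball. -/
theorem StronglyConvexOnDom.exists_isMin [FiniteDimensional ℝ H] {μ : ℝ} (hμ : 0 < μ)
    {F : H → EReal} (hF : StronglyConvexOnDom μ F) (hlsc : LowerSemicontinuous F)
    (hbot : ∀ x, F x ≠ ⊥) {x₀ : H} (hx₀ : F x₀ ≠ ⊤) : ∃ xs, ∀ w, F xs ≤ F w := by
  have : ProperSpace H := FiniteDimensional.proper ℝ H
  have hball : ∀ R : ℝ, 0 ≤ R → ∃ a ∈ Metric.closedBall x₀ R,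
      IsMinOn F (Metric.closedBall x₀ R) a := fun R hR =>
    (hlsc.lowerSemicontinuousOn _).exists_isMinOn
      ⟨x₀, Metric.mem_closedBall_self hR⟩ (isCompact_closedBall x₀ R)
  obtain ⟨b, -, hbmin⟩ := hball 1 zero_le_one
  have hb : F b ≠ ⊤ := fun h => hx₀ (top_le_iff.1 (h ▸ hbmin (Metric.mem_closedBall_self
    zero_le_one)))
  set m := (F b).toReal with hm
  set c := (F x₀).toReal with hc
  have hmc : m ≤ c := by
    have := hbmin (Metric.mem_closedBall_self (x := x₀) zero_le_one)
    exact EReal.toReal_le_toReal this (hbot _) hx₀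
  -- Outside the ball of this radius, `F` exceeds its value at `x₀`.
  set R : ℝ := 2 + 2 * (c - m) / μ with hR
  have hR2 : 2 ≤ R := by
    have : 0 ≤ 2 * (c - m) / μ := by
      have : 0 ≤ c - m := by linarith
      positivity
    linarith
  obtain ⟨a, -, hamin⟩ := hball R (by linarith)
  refine ⟨a, fun w => ?_⟩
  by_cases hw : w ∈ Metric.closedBall x₀ R
  · exact hamin hw
  refine (hamin (Metric.mem_closedBall_self (by linarith))).trans ?_
  by_cases hwt : F w = ⊤
  · rw [hwt]; exact le_top
  rw [Metric.mem_closedBall, not_le, dist_eq_norm] at hw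
  set r := ‖w - x₀‖ with hr
  have hr0 : 0 < r := by linarith
  have ht1 : 1 / r ≤ 1 := by rw [div_le_one hr0]; linarith
  have hconv := hF w x₀ hwt hx₀ (1 / r) (by positivity) ht1
  have hmem : (1 / r) • w + (1 - 1 / r) • x₀ ∈ Metric.closedBall x₀ 1 := by
    rw [Metric.mem_closedBall, dist_eq_norm]
    have e : (1 / r) • w + (1 - 1 / r) • x₀ - x₀ = (1 / r) • (w - x₀) := by module
    rw [e, norm_smul, Real.norm_of_nonneg (by positivity), ← hr, one_div,
      inv_mul_cancel₀ hr0.ne']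
  have h := (hbmin hmem).trans hconv
  rw [← EReal.coe_toReal hb (hbot b), EReal.coe_le_coe_iff, ← hm, ← hc, ← hr] at h
  have h2 : r * m ≤ (F w).toReal + (r - 1) * c - 1 / 2 * μ * (r - 1) * r := by
    have h3 := mul_le_mul_of_nonneg_left h hr0.le
    have e : r * (1 / r * (F w).toReal + (1 - 1 / r) * c
        - 1 / 2 * μ * (1 / r) * (1 - 1 / r) * r ^ 2) =
        (F w).toReal + (r - 1) * c - 1 / 2 * μ * (r - 1) * r := by
      field_simp
    rwa [e] at h3
  have h4 : c - m ≤ 1 / 2 * μ * (r - 1) := by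
    have h5 : 2 * (c - m) / μ ≤ r - 1 := by linarith
    rw [div_le_iff₀ hμ] at h5
    linarith
  have h6 : c ≤ (F w).toReal := by nlinarith [mul_le_mul_of_nonneg_left h4 hr0.le]
  rw [← EReal.coe_toReal hx₀ (hbot _), ← EReal.coe_toReal hwt (hbot _)]
  exact_mod_cast h6

/-- The proximal point `q` of `x` satisfies `r (x - q) ∈ ∂ f (q)`. -/
theorem exists_prox [FiniteDimensional ℝ H] {f : H → EReal} (hf : IsConvexFn f)
    (hlsc : LowerSemicontinuous f) (hbot : ∀ x, f x ≠ ⊥) {x : H} (hx : f x ≠ ⊤) {r : ℝ}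
    (hr : 0 < r) : ∃ q, f q ≠ ⊤ ∧ r • (x - q) ∈ subdiff f q ∧
      ∀ w, f w ≠ ⊤ → (f q).toReal + r / 2 * ‖q - x‖ ^ 2 ≤
        (f w).toReal + r / 2 * ‖w - x‖ ^ 2 := by
  set Q : H → EReal := fun w => ((r / 2 * ‖w - x‖ ^ 2 : ℝ) : EReal) with hQ
  have hQb : ∀ w, Q w ≠ ⊥ := fun w => EReal.coe_ne_bot _
  have hQt : ∀ w, Q w ≠ ⊤ := fun w => EReal.coe_ne_top _
  have hsc : StronglyConvexOnDom r (fun w => f w + Q w) := by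
    have := (hf.stronglyConvexOnDom hbot).add (stronglyConvexOnDom_sq x r) hbot hQb
    rwa [zero_add] at this
  have hQl : LowerSemicontinuous Q :=
    (continuous_coe_real_ereal.comp (by fun_prop)).lowerSemicontinuous
  have hsum : ∀ w, f w ≠ ⊤ → f w + Q w ≠ ⊤ := fun w hw => EReal.add_ne_top hw (hQt w)
  have hsumb : ∀ w, f w + Q w ≠ ⊥ := fun w => by
    rw [Ne, EReal.add_eq_bot_iff, not_or]; exact ⟨hbot w, hQb w⟩
  obtain ⟨q, hq⟩ := hsc.exists_isMin hr (lowerSemicontinuous_add_of_ne_bot hlsc hQl hbot hQb)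
    hsumb (hsum x hx)
  have hqt : f q ≠ ⊤ := by
    intro h
    have := hq x
    rw [h, EReal.top_add_of_ne_bot (hQb q), top_le_iff] at this
    exact hsum x hx this
  have hgrow : ∀ w, f w ≠ ⊤ → (f q).toReal + r / 2 * ‖q - x‖ ^ 2 + r / 2 * ‖w - q‖ ^ 2 ≤
      (f w).toReal + r / 2 * ‖w - x‖ ^ 2 := by
    intro w hw
    have := hsc.growth_of_isMin hsumb hq (hsum w hw)
    rwa [EReal.toReal_add hqt (hbot q) (hQt q) (hQb q),
      EReal.toReal_add hw (hbot w) (hQt w) (hQb w), hQ, EReal.toReal_coe, EReal.toReal_coe] at this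
  refine ⟨q, hqt, fun w => ?_, fun w hw => ?_⟩
  · by_cases hw : f w = ⊤
    · rw [hw]; exact le_top
    rw [← EReal.coe_toReal hqt (hbot q), ← EReal.coe_toReal hw (hbot w)]
    norm_cast
    have h1 := hgrow w hw
    have h2 : ‖w - x‖ ^ 2 = ‖w - q‖ ^ 2 - 2 * inner ℝ (x - q) (w - q) + ‖q - x‖ ^ 2 := by
      rw [← sub_sub_sub_cancel_right w x q, norm_sub_sq_real, real_inner_comm, norm_sub_rev x q]
    rw [inner_smul_left, conj_trivial]
    nlinarith
  · have h1 := hgrow w hw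
    have : 0 ≤ r / 2 * ‖w - q‖ ^ 2 := by positivity
    linarith

/-- The effective domain of a closed convex function lies in the closure of the domain of its
subdifferential, since the proximal points of `x ∈ dom f` converge to `x`. -/
theorem mem_closure_domSubdiff [FiniteDimensional ℝ H] {f : H → EReal} (hf : IsConvexFn f)
    (hlsc : LowerSemicontinuous f) (hbot : ∀ x, f x ≠ ⊥) {x : H} (hx : f x ≠ ⊤) :
    x ∈ closure (domSubdiff f) := by
  obtain ⟨q₁, hq₁, -, hmin⟩ := exists_prox hf hlsc hbot hx one_pos
  set K := (f x).toReal - ((f q₁).toReal + 1 / 2 * ‖q₁ - x‖ ^ 2) with hK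
  have hK0 : 0 ≤ K := by
    have := hmin x hx
    simp only [sub_self, norm_zero] at this
    linarith
  rw [Metric.mem_closure_iff]
  intro δ hδ
  -- The proximal parameter is chosen so that the proximal point is `δ`-close to `x`.
  have hr : 0 < 2 + 2 * K / δ ^ 2 := by positivity
  obtain ⟨q, hq, hsub, hqmin⟩ := exists_prox hf hlsc hbot hx hr
  refine ⟨q, ⟨_, hsub⟩, ?_⟩
  have h1 := hqmin x hx
  have h2 := hmin q hq
  simp only [sub_self, norm_zero] at h1
  rw [dist_comm, dist_eq_norm]
  by_contra! hcon
  have h3 : δ ^ 2 ≤ ‖q - x‖ ^ 2 := by gcongr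
  have h4 : (1 + 2 * K / δ ^ 2) / 2 * ‖q - x‖ ^ 2 ≤ K := by linarith
  have h5 : (1 + 2 * K / δ ^ 2) / 2 * δ ^ 2 ≤ K := le_trans (by gcongr) h4
  have h6 : (1 + 2 * K / δ ^ 2) / 2 * δ ^ 2 = δ ^ 2 / 2 + K := by field_simp
  have : 0 < δ ^ 2 := by positivity
  linarith

/-- The gradient inequality for a strongly convex function at a point of differentiability. -/
theorem StronglyConvexOnDom.gradient_inequality [CompleteSpace H] {μ : ℝ} {g : H → EReal}
    (hg : StronglyConvexOnDom μ g) (hbot : ∀ x, g x ≠ ⊥) {y w : H} (hy : g y ≠ ⊤)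
    (hd : DifferentiableAt ℝ (realPart g) y) (hw : g w ≠ ⊤) :
    (g y).toReal + inner ℝ (gradient (realPart g) y) (w - y) + μ / 2 * ‖w - y‖ ^ 2 ≤
      (g w).toReal := by
  have hline : HasDerivAt (fun t : ℝ => y + t • (w - y)) (w - y) 0 := by
    simpa using ((hasDerivAt_id (0 : ℝ)).smul_const (w - y)).const_add y
  have hder : HasDerivAt (fun t : ℝ => realPart g (y + t • (w - y)))
      (inner ℝ (gradient (realPart g) y) (w - y)) 0 := by
    have h1 : HasFDerivAt (realPart g) (fderiv ℝ (realPart g) y) (y + (0 : ℝ) • (w - y)) := by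
      rw [zero_smul, add_zero]; exact hd.hasFDerivAt
    have h2 := h1.comp_hasDerivAt (0 : ℝ) hline
    refine h2.congr_deriv ?_
    rw [gradient, InnerProductSpace.toDual_symm_apply]
  have hslope := (hder.tendsto_slope).mono_left
    (nhdsWithin_mono (0 : ℝ) (fun t (ht : t ∈ Set.Ioi (0 : ℝ)) => ne_of_gt ht))
  have hlim : Tendsto (fun t : ℝ => (g w).toReal - (g y).toReal - μ / 2 * (1 - t) * ‖w - y‖ ^ 2)
      (𝓝[>] 0) (𝓝 ((g w).toReal - (g y).toReal - μ / 2 * (1 - 0) * ‖w - y‖ ^ 2)) :=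
    (Continuous.tendsto (by fun_prop) 0).mono_left nhdsWithin_le_nhds
  have := le_of_tendsto_of_tendsto hslope hlim (by
    filter_upwards [Ioo_mem_nhdsGT (zero_lt_one (α := ℝ))] with t ht
    have hc := hg w y hw hy t ht.1.le ht.2.le
    have e : t • w + (1 - t) • y = y + t • (w - y) := by module
    rw [e] at hc
    have ht' : g (y + t • (w - y)) ≠ ⊤ := ne_top_of_le_ne_top (EReal.coe_ne_top _) hc
    rw [← EReal.coe_toReal ht' (hbot _), EReal.coe_le_coe_iff] at hc
    rw [slope_def_field, div_le_iff₀ (by linarith [ht.1])]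
    simp only [realPart, zero_smul, add_zero, sub_zero]
    linarith)
  linarith

/-! ### One step of the accelerated hybrid proximal extragradient method -/

/-- The quadratic lower model of the objective at `y`, regularized by the proximal term, is bounded
below by the relative-error criterion. -/
theorem prox_model_lower_bound {μ lam ε s : ℝ} (hμ : 0 ≤ μ) (hlam : 0 < lam) {y xt v : H}
    (hres : ‖lam • v + y - xt‖ ^ 2 / (1 + lam * μ) + 2 * lam * ε ≤ s ^ 2 * ‖y - xt‖ ^ 2) (w : H) :
    (1 - s ^ 2) / (2 * lam) * ‖y - xt‖ ^ 2 ≤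
      inner ℝ v (w - y) + μ / 2 * ‖w - y‖ ^ 2 - ε + 1 / (2 * lam) * ‖w - xt‖ ^ 2 := by
  have hpos : 0 < 1 + lam * μ := by positivity
  set r := lam • v + y - xt with hr
  have hsq : 0 ≤ ‖r + (1 + lam * μ) • (w - y)‖ ^ 2 := by positivity
  rw [norm_add_sq_real, norm_smul, inner_smul_right, Real.norm_of_nonneg hpos.le] at hsq
  have h1 : 0 ≤ ‖r‖ ^ 2 / (1 + lam * μ) + 2 * inner ℝ r (w - y)
      + (1 + lam * μ) * ‖w - y‖ ^ 2 := by
    have : ‖r‖ ^ 2 / (1 + lam * μ) + 2 * inner ℝ r (w - y) + (1 + lam * μ) * ‖w - y‖ ^ 2 =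
        (‖r‖ ^ 2 + 2 * ((1 + lam * μ) * inner ℝ r (w - y))
          + ((1 + lam * μ) * ‖w - y‖) ^ 2) / (1 + lam * μ) := by
      field_simp
    rw [this]
    positivity
  have h2 : inner ℝ r (w - y) = lam * inner ℝ v (w - y) + inner ℝ (y - xt) (w - y) := by
    rw [hr, add_sub_assoc, inner_add_left, inner_smul_left, conj_trivial]
  have h3 : ‖w - xt‖ ^ 2 = ‖w - y‖ ^ 2 + 2 * inner ℝ (y - xt) (w - y) + ‖y - xt‖ ^ 2 := by
    rw [← sub_add_sub_cancel w y xt, norm_add_sq_real, real_inner_comm]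
  have h4 : 0 ≤ 2 * lam * (inner ℝ v (w - y) + μ / 2 * ‖w - y‖ ^ 2 - ε
      + 1 / (2 * lam) * ‖w - xt‖ ^ 2 - (1 - s ^ 2) / (2 * lam) * ‖y - xt‖ ^ 2) := by
    have : 2 * lam * (inner ℝ v (w - y) + μ / 2 * ‖w - y‖ ^ 2 - ε
      + 1 / (2 * lam) * ‖w - xt‖ ^ 2 - (1 - s ^ 2) / (2 * lam) * ‖y - xt‖ ^ 2) =
        2 * lam * inner ℝ v (w - y) + lam * μ * ‖w - y‖ ^ 2 - 2 * lam * ε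
          + ‖w - xt‖ ^ 2 - (1 - s ^ 2) * ‖y - xt‖ ^ 2 := by
      field_simp
    rw [this, h3]
    rw [h2] at h1
    linarith
  have h5 := nonneg_of_mul_nonneg_right h4 (by positivity : (0 : ℝ) < 2 * lam)
  linarith

/-- The squared norm of a convex combination, with unnormalized weights. -/
theorem norm_add_smul_sq_le (α β : ℝ) (P Q : H) (hα : 0 ≤ α) (hβ : 0 ≤ β) :
    ‖α • P + β • Q‖ ^ 2 ≤ (α + β) * (α * ‖P‖ ^ 2 + β * ‖Q‖ ^ 2) := by
  have h : 0 ≤ ‖P - Q‖ ^ 2 := by positivity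
  rw [norm_sub_sq_real] at h
  rw [norm_add_sq_real, norm_smul, norm_smul, inner_smul_left, inner_smul_right, mul_pow, mul_pow,
    Real.norm_eq_abs, Real.norm_eq_abs, sq_abs, sq_abs, conj_trivial]
  nlinarith [mul_nonneg (mul_nonneg hα hβ) h]

/-- The step size `a` solves the quadratic equation that makes the extrapolation exact. -/
theorem step_size_facts {μ A lam a : ℝ} (hμ : 0 < μ) (hA : 0 ≤ A) (hlam : 0 < lam)
    (ha : a = ((1 + 2 * μ * A) * lam
      + √((1 + 2 * μ * A) ^ 2 * lam ^ 2 + 4 * (1 + μ * A) * A * lam)) / 2) :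
    a ^ 2 = lam * ((1 + μ * A) * (A + a) + μ * A * a) ∧ (1 + 2 * μ * A) * lam ≤ a := by
  have hμA : 0 ≤ μ * A := by positivity
  have hD : 0 ≤ (1 + 2 * μ * A) ^ 2 * lam ^ 2 + 4 * (1 + μ * A) * A * lam := by positivity
  have hs := Real.sq_sqrt hD
  constructor
  · have h2 : √((1 + 2 * μ * A) ^ 2 * lam ^ 2 + 4 * (1 + μ * A) * A * lam) =
        2 * a - (1 + 2 * μ * A) * lam := by rw [ha]; ring
    rw [h2] at hs
    linarith
  · have hle : (1 + 2 * μ * A) * lam ≤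
        √((1 + 2 * μ * A) ^ 2 * lam ^ 2 + 4 * (1 + μ * A) * A * lam) := by
      apply Real.le_sqrt_of_sq_le
      have : 0 ≤ 4 * (1 + μ * A) * A * lam := by positivity
      linarith
    linarith

/-- The proximal quadratic of the averaged point is dominated by the strongly convex terms. -/
theorem averaging_lower_bound {μ A a lam : ℝ} (hμ : 0 < μ) (hA : 0 ≤ A) (hlam : 0 < lam)
    (ha : a ^ 2 = lam * ((1 + μ * A) * (A + a) + μ * A * a)) (hal : (1 + 2 * μ * A) * lam ≤ a)
    {x x' y y' xt : H}
    (hxt : xt = ((a - μ * A * lam) / (A + a)) • x + ((A + μ * A * lam) / (A + a)) • y) :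
    (A + a) * (μ / 2 * ‖(A / (A + a)) • y + (a / (A + a)) • x' - y'‖ ^ 2
        + 1 / (2 * lam) * ‖(A / (A + a)) • y + (a / (A + a)) • x' - xt‖ ^ 2) ≤
      (1 + μ * A) / 2 * ‖x' - x‖ ^ 2 + A * (μ / 2 * ‖y - y'‖ ^ 2)
        + a * (μ / 2 * ‖x' - y'‖ ^ 2) := by
  have hμA : 0 ≤ μ * A := by positivity
  have ha0 : 0 < a := lt_of_lt_of_le (by positivity) hal
  have hAa : 0 < A + a := by positivity
  set S := A + a with hS
  have hα : 0 ≤ a - μ * A * lam := by nlinarith [mul_nonneg hμA hlam.le]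
  have hβ : 0 ≤ μ * A * lam := by positivity
  have hAS : 1 - A / S = a / S := by field_simp; rw [hS]; ring
  have e1 : ‖(A / S) • y + (a / S) • x' - y'‖ ^ 2 =
      A / S * ‖y - y'‖ ^ 2 + a / S * ‖x' - y'‖ ^ 2 - A / S * (a / S) * ‖x' - y‖ ^ 2 := by
    have := norm_sub_sq_convexComb y x' y' (A / S)
    rwa [hAS, norm_sub_rev y x'] at this
  have e2 : (A / S) • y + (a / S) • x' - xt =
      (1 / S) • ((a - μ * A * lam) • (x' - x) + (μ * A * lam) • (x' - y)) := by
    rw [hxt]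
    match_scalars <;> field_simp <;> ring
  have h3 := norm_add_smul_sq_le (a - μ * A * lam) (μ * A * lam) (x' - x) (x' - y) hα hβ
  rw [sub_add_cancel] at h3
  have h4 : a * (a - μ * A * lam) = lam * ((1 + μ * A) * S) := by linear_combination ha
  rw [e1, e2, norm_smul, mul_pow, Real.norm_of_nonneg (by positivity)]
  have h5 : S * (1 / (2 * lam) * ((1 / S) ^ 2 * ‖(a - μ * A * lam) • (x' - x)
      + (μ * A * lam) • (x' - y)‖ ^ 2)) ≤
      S * (1 / (2 * lam) * ((1 / S) ^ 2 * (a * ((a - μ * A * lam) * ‖x' - x‖ ^ 2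
        + μ * A * lam * ‖x' - y‖ ^ 2)))) := by gcongr
  have h6 : S * (1 / (2 * lam) * ((1 / S) ^ 2 * (a * ((a - μ * A * lam) * ‖x' - x‖ ^ 2
        + μ * A * lam * ‖x' - y‖ ^ 2)))) =
      (1 + μ * A) / 2 * ‖x' - x‖ ^ 2 + μ / 2 * (A * a / S) * ‖x' - y‖ ^ 2 := by
    have : a * ((a - μ * A * lam) * ‖x' - x‖ ^ 2 + μ * A * lam * ‖x' - y‖ ^ 2) =
        lam * ((1 + μ * A) * S) * ‖x' - x‖ ^ 2 + a * (μ * A * lam) * ‖x' - y‖ ^ 2 := by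
      rw [← h4]; ring
    rw [this]
    field_simp
  have h7 : S * (μ / 2 * (A / S * ‖y - y'‖ ^ 2 + a / S * ‖x' - y'‖ ^ 2
      - A / S * (a / S) * ‖x' - y‖ ^ 2)) =
      A * (μ / 2 * ‖y - y'‖ ^ 2) + a * (μ / 2 * ‖x' - y'‖ ^ 2)
        - μ / 2 * (A * a / S) * ‖x' - y‖ ^ 2 := by
    field_simp
  rw [mul_add, h7]
  linarith

/-- The extragradient point `x'` minimizes a quadratic whose expansion around `x'` is exact. -/
theorem extragradient_expansion {μ A a : ℝ} (hS : 1 + μ * (A + a) ≠ 0) {x x' y' v : H}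
    (hx' : x' = ((1 + μ * A) / (1 + μ * (A + a))) • x + (μ * a / (1 + μ * (A + a))) • y'
      - (a / (1 + μ * (A + a))) • v) (w : H) :
    (1 + μ * A) / 2 * ‖w - x‖ ^ 2 + a * (inner ℝ v (w - y') + μ / 2 * ‖w - y'‖ ^ 2) =
      (1 + μ * A) / 2 * ‖x' - x‖ ^ 2 + a * (inner ℝ v (x' - y') + μ / 2 * ‖x' - y'‖ ^ 2)
        + (1 + μ * (A + a)) / 2 * ‖w - x'‖ ^ 2 := by
  have h0 : (1 + μ * A) • (x' - x) + (μ * a) • (x' - y') + a • v = 0 := by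
    rw [hx']
    match_scalars <;> field_simp <;> ring
  have h1 : (1 + μ * A) * inner ℝ (x' - x) (w - x') + μ * a * inner ℝ (x' - y') (w - x')
      + a * inner ℝ v (w - x') = 0 := by
    have := congrArg (fun q => inner ℝ q (w - x')) h0
    simpa only [inner_add_left, inner_smul_left, conj_trivial, inner_zero_left] using this
  have e1 : ‖w - x‖ ^ 2 = ‖x' - x‖ ^ 2 + 2 * inner ℝ (x' - x) (w - x') + ‖w - x'‖ ^ 2 := by
    rw [← norm_add_sq_real, add_comm, sub_add_sub_cancel]
  have e2 : ‖w - y'‖ ^ 2 = ‖x' - y'‖ ^ 2 + 2 * inner ℝ (x' - y') (w - x') + ‖w - x'‖ ^ 2 := by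
    rw [← norm_add_sq_real, add_comm, sub_add_sub_cancel]
  have e3 : inner ℝ v (w - y') = inner ℝ v (w - x') + inner ℝ v (x' - y') := by
    rw [← inner_add_right, sub_add_sub_cancel]
  rw [e1, e2, e3]
  linear_combination h1

/-- The energy `A (h(y) - h(x*)) + (1 + μ A) / 2 ‖x* - x‖²` decreases along one step, by at least
a multiple of `‖y' - xt‖²`. The hypothesis `hmodel_y` is vacuous when `A = 0`, where `y` may lie
outside the domain of the objective. -/
theorem energy_step {μ A a lam ε s : ℝ} (hμ : 0 < μ) (hA : 0 ≤ A) (hlam : 0 < lam)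
    (ha : a ^ 2 = lam * ((1 + μ * A) * (A + a) + μ * A * a)) (hal : (1 + 2 * μ * A) * lam ≤ a)
    {x x' y y' xt v xs : H} {hy hy' hs : ℝ}
    (hxt : xt = ((a - μ * A * lam) / (A + a)) • x + ((A + μ * A * lam) / (A + a)) • y)
    (hx' : x' = ((1 + μ * A) / (1 + μ * (A + a))) • x + (μ * a / (1 + μ * (A + a))) • y'
      - (a / (1 + μ * (A + a))) • v)
    (hres : ‖lam • v + y' - xt‖ ^ 2 / (1 + lam * μ) + 2 * lam * ε ≤ s ^ 2 * ‖y' - xt‖ ^ 2)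
    (hmodel_y : A * (hy' + inner ℝ v (y - y') + μ / 2 * ‖y - y'‖ ^ 2 - ε) ≤ A * hy)
    (hmodel_xs : hy' + inner ℝ v (xs - y') + μ / 2 * ‖xs - y'‖ ^ 2 - ε ≤ hs) :
    (A + a) * (hy' - hs) + (1 + μ * (A + a)) / 2 * ‖xs - x'‖ ^ 2
        + (1 - s ^ 2) / 2 * ((A + a) / lam * ‖y' - xt‖ ^ 2) ≤
      A * (hy - hs) + (1 + μ * A) / 2 * ‖xs - x‖ ^ 2 := by
  have hμA : 0 ≤ μ * A := by positivity
  have ha0 : 0 < a := lt_of_lt_of_le (by positivity) hal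
  have hAa : 0 < A + a := by positivity
  have h1 := extragradient_expansion (by positivity : 1 + μ * (A + a) ≠ 0) hx' xs
  have h2 := averaging_lower_bound hμ hA hlam ha hal (x' := x') (y' := y') hxt
  have h3 := mul_le_mul_of_nonneg_left
    (prox_model_lower_bound hμ.le hlam hres ((A / (A + a)) • y + (a / (A + a)) • x')) hAa.le
  have e : (A / (A + a)) • y + (a / (A + a)) • x' - y' =
      (A / (A + a)) • (y - y') + (a / (A + a)) • (x' - y') := by
    match_scalars
    all_goals field_simp
    ring
  have h4 : (A + a) * inner ℝ v ((A / (A + a)) • y + (a / (A + a)) • x' - y') =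
      A * inner ℝ v (y - y') + a * inner ℝ v (x' - y') := by
    rw [e, inner_add_right, inner_smul_right, inner_smul_right]
    field_simp
  have h5 := mul_le_mul_of_nonneg_left hmodel_xs ha0.le
  have h6 : (A + a) * ((1 - s ^ 2) / (2 * lam) * ‖y' - xt‖ ^ 2) =
      (1 - s ^ 2) / 2 * ((A + a) / lam * ‖y' - xt‖ ^ 2) := by field_simp
  linarith

/-- Replacing the gradient of the model by that of `g` turns a `σhat`-approximate solution into a
solution with relative error `σu + σhat`. -/
theorem residual_of_model_residual {V : Type*} [SeminormedAddCommGroup V] {lam μ ε s σu δ : ℝ}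
    {r e : V} (hlam : 0 < lam) (hμ : 0 < μ)
    (hε : 0 ≤ ε) (hs : 0 ≤ s) (hδ : 0 ≤ δ) (hσu : 0 ≤ σu)
    (hr : ‖r‖ ^ 2 / (1 + lam * μ) + 2 * lam * ε ≤ s ^ 2 * δ ^ 2)
    (he : ‖e‖ ≤ σu * √(1 + lam * μ) * δ) :
    ‖r + e‖ ^ 2 / (1 + lam * μ) + 2 * lam * ε ≤ (σu + s) ^ 2 * δ ^ 2 := by
  have hpos : 0 < 1 + lam * μ := by positivity
  set q := √(1 + lam * μ) with hq
  have hq0 : 0 < q := Real.sqrt_pos.2 hpos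
  have hq2 : 1 + lam * μ = q ^ 2 := (Real.sq_sqrt hpos.le).symm
  rw [hq2, ← div_pow] at hr ⊢
  have hε' : 0 ≤ 2 * lam * ε := by positivity
  have h1 : ‖r‖ / q ≤ s * δ := by
    refine le_of_sq_le_sq ?_ (by positivity)
    rw [mul_pow]; linarith
  have h2 : ‖r + e‖ / q ≤ ‖r‖ / q + σu * δ := by
    rw [div_le_iff₀ hq0, add_mul, div_mul_cancel₀ _ hq0.ne']
    refine (norm_add_le _ _).trans ?_
    linarith
  have h3 : (‖r + e‖ / q) ^ 2 ≤ (‖r‖ / q + σu * δ) ^ 2 := by gcongr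
  have h4 : ‖r‖ / q * (σu * δ) ≤ s * δ * (σu * δ) := by gcongr
  linarith

/-! ### Growth of the aggregated step sizes -/

section Growth

variable {μ D q : ℝ} {lam A : ℕ → ℝ}

theorem prod_le_aggregated (hμ : 0 < μ) (hlam : ∀ k, 0 < lam (k + 1)) (hA1 : A 1 = lam 1)
    (hrec : ∀ k, (1 + 2 * μ * lam (k + 2)) * A (k + 1) ≤ A (k + 2)) (k : ℕ) :
    lam 1 * ∏ j ∈ Finset.range k, (1 + 2 * μ * lam (j + 2)) ≤ A (k + 1) := by
  induction k with
  | zero => simp [hA1]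
  | succ k ih =>
    have : 0 < 1 + 2 * μ * lam (k + 2) := by have := hlam (k + 1); positivity
    rw [Finset.prod_range_succ]
    calc _ = (1 + 2 * μ * lam (k + 2)) *
          (lam 1 * ∏ j ∈ Finset.range k, (1 + 2 * μ * lam (j + 2))) := by ring
      _ ≤ (1 + 2 * μ * lam (k + 2)) * A (k + 1) := by gcongr
      _ ≤ _ := hrec k

theorem lam_one_le_aggregated (hμ : 0 < μ) (hlam : ∀ k, 0 < lam (k + 1)) (hA1 : A 1 = lam 1)
    (hrec : ∀ k, (1 + 2 * μ * lam (k + 2)) * A (k + 1) ≤ A (k + 2)) (k : ℕ) :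
    lam 1 ≤ A (k + 1) := by
  refine le_trans ?_ (prod_le_aggregated hμ hlam hA1 hrec k)
  refine le_mul_of_one_le_right (hlam 0).le ?_
  have h : ∀ j ∈ Finset.range k, (1 : ℝ) ≤ 1 + 2 * μ * lam (j + 2) := fun j _ => by
    have := hlam (j + 1)
    have : 0 ≤ 2 * μ * lam (j + 2) := by positivity
    linarith
  calc (1 : ℝ) = ∏ _j ∈ Finset.range k, (1 : ℝ) := by simp
    _ ≤ _ := Finset.prod_le_prod (fun _ _ => zero_le_one) h

/-- Tangent-line form of the convexity of `s ↦ log (1 + c exp s)` at `s = 0`. -/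
theorem log_one_add_mul_ge {c b : ℝ} (hc : 0 < c) (hb : 0 < b) :
    Real.log (1 + c) + c / (1 + c) * Real.log b ≤ Real.log (1 + c * b) := by
  have h := strictConcaveOn_log_Ioi.concaveOn.2 (Set.mem_Ioi.2 one_pos) (Set.mem_Ioi.2 hb)
    (by positivity : 0 ≤ 1 / (1 + c)) (by positivity : 0 ≤ c / (1 + c))
    (by field_simp)
  simp only [smul_eq_mul, Real.log_one, mul_zero, zero_add, mul_one] at h
  have e : 1 / (1 + c) + c / (1 + c) * b = (1 + c * b) / (1 + c) := by field_simp
  rw [e, Real.log_div (by positivity) (by positivity)] at h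
  linarith

/-- If positive numbers have a bounded sum of `(-q)`-th powers, the product of `1 + κ t_j` is at
least what it would be if all of them were equal. -/
theorem pow_le_prod_one_add {κ : ℝ} (hκ : 0 < κ) (hD : 0 < D) (hq : 0 < q) (k : ℕ)
    {t : ℕ → ℝ} (ht : ∀ j, 0 < t j) (hsum : ∑ j ∈ Finset.range k, (D / t j) ^ q ≤ 1) :
    (1 + κ * D * (k : ℝ) ^ (1 / q)) ^ k ≤ ∏ j ∈ Finset.range k, (1 + κ * t j) := by
  rcases Nat.eq_zero_or_pos k with rfl | hk
  · simp
  have hk' : (0 : ℝ) < k := by exact_mod_cast hk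
  set m := D * (k : ℝ) ^ (1 / q) with hm
  have hm0 : 0 < m := by positivity
  -- The geometric mean of the `t j` is at least `m`, by `log s ≤ s - 1` at `s = (t j / m) ^ (-q)`.
  have hlog : 0 ≤ ∑ j ∈ Finset.range k, Real.log (t j / m) := by
    have h1 : ∀ j ∈ Finset.range k, -q * Real.log (t j / m) ≤ k * (D / t j) ^ q - 1 := by
      intro j _
      have htj := ht j
      have h2 := Real.log_le_sub_one_of_pos (Real.rpow_pos_of_pos (div_pos htj hm0) (-q))
      rw [Real.log_rpow (div_pos htj hm0)] at h2
      have h3 : (t j / m) ^ (-q) = k * (D / t j) ^ q := by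
        rw [Real.rpow_neg (by positivity), ← Real.inv_rpow (by positivity), inv_div, hm,
          mul_div_right_comm, Real.mul_rpow (by positivity) (by positivity), ← Real.rpow_mul hk'.le,
          one_div_mul_cancel hq.ne', Real.rpow_one, mul_comm]
      rwa [h3] at h2
    have h4 := Finset.sum_le_sum h1
    rw [← Finset.mul_sum, Finset.sum_sub_distrib, ← Finset.mul_sum] at h4
    simp only [Finset.sum_const, Finset.card_range, nsmul_eq_mul, mul_one] at h4
    have h5 := mul_le_mul_of_nonneg_left hsum hk'.le
    have h6 : 0 ≤ q * ∑ j ∈ Finset.range k, Real.log (t j / m) := by linarith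
    exact nonneg_of_mul_nonneg_right h6 hq
  have hc : 0 < κ * m := by positivity
  have hpos : ∀ j, 0 < 1 + κ * t j := fun j => by have := ht j; positivity
  rw [mul_assoc, ← Real.log_le_log_iff (by positivity) (Finset.prod_pos fun j _ => hpos j),
    Real.log_pow, Real.log_prod fun j _ => (hpos j).ne']
  have h7 : ∀ j ∈ Finset.range k, Real.log (1 + κ * m)
      + κ * m / (1 + κ * m) * Real.log (t j / m) ≤ Real.log (1 + κ * t j) := by
    intro j _
    have := log_one_add_mul_ge hc (div_pos (ht j) hm0)
    rwa [mul_assoc κ m, mul_div_cancel₀ _ hm0.ne'] at this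
  have h8 := Finset.sum_le_sum h7
  rw [Finset.sum_add_distrib, ← Finset.mul_sum] at h8
  simp only [Finset.sum_const, Finset.card_range, nsmul_eq_mul] at h8
  have h9 : 0 ≤ κ * m / (1 + κ * m) * ∑ j ∈ Finset.range k, Real.log (t j / m) := by positivity
  linarith

/-- The growth of the aggregated step sizes behind the explicit complexity bounds: the weights in
the summability hypothesis are bounded below by one. -/
theorem growth_le_aggregated (hμ : 0 < μ) (hD : 0 < D) (hq : 0 < q)
    (hlam : ∀ k, 0 < lam (k + 1)) (hA1 : A 1 = lam 1)
    (hrec : ∀ k, (1 + 2 * μ * lam (k + 2)) * A (k + 1) ≤ A (k + 2))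
    (hsum : ∀ n, ∑ j ∈ Finset.range n, A (j + 1) / lam 1 * (D / lam (j + 1)) ^ q ≤ 1) (k : ℕ) :
    lam 1 * (1 + 2 * μ * D * (k : ℝ) ^ (1 / q)) ^ k ≤ A (k + 1) := by
  refine le_trans ?_ (prod_le_aggregated hμ hlam hA1 hrec k)
  refine mul_le_mul_of_nonneg_left ?_ (hlam 0).le
  refine pow_le_prod_one_add (by positivity) hD hq k (t := fun j => lam (j + 2))
    (fun j => hlam (j + 1)) ?_
  have h := hsum (k + 1)
  rw [Finset.sum_range_succ'] at h
  have h0 : 0 ≤ A (0 + 1) / lam 1 * (D / lam (0 + 1)) ^ q := by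
    have := hlam 0
    rw [zero_add, hA1]
    positivity
  refine le_trans (Finset.sum_le_sum fun j _ => ?_) (by linarith : _ ≤ (1 : ℝ))
  have h1 : 1 ≤ A (j + 1 + 1) / lam 1 := by
    rw [one_le_div (hlam 0)]
    exact lam_one_le_aggregated hμ hlam hA1 hrec (j + 1)
  have h2 : 0 ≤ (D / lam (j + 1 + 1)) ^ q := by have := hlam (j + 1); positivity
  exact le_mul_of_one_le_left h2 h1

/-- A step size is bounded below in terms of the current aggregated step size. -/
theorem mul_rpow_aggregated_le (hμ : 0 < μ) (hD : 0 < D) (hq : 0 < q)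
    (hlam : ∀ k, 0 < lam (k + 1)) (hA1 : A 1 = lam 1)
    (hrec : ∀ k, (1 + 2 * μ * lam (k + 2)) * A (k + 1) ≤ A (k + 2))
    (hsum : ∀ n, ∑ j ∈ Finset.range n, A (j + 1) / lam 1 * (D / lam (j + 1)) ^ q ≤ 1) (k : ℕ) :
    D * (A (k + 1) / lam 1) ^ (1 / q) ≤ lam (k + 1) := by
  have hl1 := hlam 0
  have hA : ∀ k, 0 < A (k + 1) := fun k =>
    lt_of_lt_of_le (hlam 0) (lam_one_le_aggregated hμ hlam hA1 hrec k)
  have h := hsum (k + 1)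
  rw [Finset.sum_range_succ] at h
  have h0 : 0 ≤ ∑ j ∈ Finset.range k, A (j + 1) / lam 1 * (D / lam (j + 1)) ^ q :=
    Finset.sum_nonneg fun j _ => by
      have := hlam j
      have := hA j
      positivity
  have hl := hlam k
  have hAk := hA k
  have h1 : A (k + 1) / lam 1 ≤ (lam (k + 1) / D) ^ q := by
    rw [← inv_div D, Real.inv_rpow (by positivity), ← one_div,
      le_div_iff₀ (by positivity)]
    linarith
  have h2 : (A (k + 1) / lam 1) ^ (1 / q) ≤ ((lam (k + 1) / D) ^ q) ^ (1 / q) := by gcongr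
  rw [← Real.rpow_mul (by positivity), mul_one_div_cancel hq.ne', Real.rpow_one,
    le_div_iff₀ hD] at h2
  linarith

/-- All step sizes are bounded below by the rate constant. -/
theorem le_lam (hμ : 0 < μ) (hD : 0 < D) (hq : 0 < q)
    (hlam : ∀ k, 0 < lam (k + 1)) (hA1 : A 1 = lam 1)
    (hrec : ∀ k, (1 + 2 * μ * lam (k + 2)) * A (k + 1) ≤ A (k + 2))
    (hsum : ∀ n, ∑ j ∈ Finset.range n, A (j + 1) / lam 1 * (D / lam (j + 1)) ^ q ≤ 1) (k : ℕ) :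
    D ≤ lam (k + 1) := by
  refine le_trans ?_ (mul_rpow_aggregated_le hμ hD hq hlam hA1 hrec hsum k)
  refine le_mul_of_one_le_right hD.le (Real.one_le_rpow ?_ (by positivity))
  rw [one_le_div (hlam 0)]
  exact lam_one_le_aggregated hμ hlam hA1 hrec k

/-- The aggregated step sizes eventually dominate a multiple of `k ^ k`. Here the feedback of
`A` into the step sizes is essential: the bound `growth_le_aggregated` only gives a multiple
of `c ^ k * k ^ (k / q)`, where `c` may be less than one. -/
theorem exists_mul_pow_self_le (hμ : 0 < μ) (hD : 0 < D) (hq : 0 < q)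
    (hlam : ∀ k, 0 < lam (k + 1)) (hA1 : A 1 = lam 1)
    (hrec : ∀ k, (1 + 2 * μ * lam (k + 2)) * A (k + 1) ≤ A (k + 2))
    (hsum : ∀ n, ∑ j ∈ Finset.range n, A (j + 1) / lam 1 * (D / lam (j + 1)) ^ q ≤ 1) :
    ∃ c > 0, ∀ᶠ k : ℕ in atTop, c * (k : ℝ) ^ k ≤ A (k + 1) := by
  have hl1 := hlam 0
  have hA : ∀ k, 0 < A (k + 1) := fun k =>
    lt_of_lt_of_le (hlam 0) (lam_one_le_aggregated hμ hlam hA1 hrec k)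
  have hDl := le_lam hμ hD hq hlam hA1 hrec hsum
  set b := (1 + 2 * μ * D) ^ (1 / q) with hb
  have hb1 : 1 < b := Real.one_lt_rpow (by have : 0 < 2 * μ * D := by positivity
                                           linarith) (by positivity)
  have hgeom : ∀ k, D * b ^ k ≤ lam (k + 1) := by
    intro k
    refine le_trans ?_ (mul_rpow_aggregated_le hμ hD hq hlam hA1 hrec hsum k)
    have h1 : (1 + 2 * μ * D) ^ k ≤ A (k + 1) / lam 1 := by
      rw [le_div_iff₀ hl1, mul_comm]
      refine le_trans ?_ (prod_le_aggregated hμ hlam hA1 hrec k)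
      have e : (1 + 2 * μ * D) ^ k = ∏ _j ∈ Finset.range k, (1 + 2 * μ * D) := by simp
      rw [e]
      gcongr with j
      exact hDl (j + 1)
    have h2 : b ^ k = ((1 + 2 * μ * D) ^ k) ^ (1 / q) := by
      rw [hb, ← Real.rpow_natCast, ← Real.rpow_natCast, ← Real.rpow_mul (by positivity),
        ← Real.rpow_mul (by positivity), mul_comm (1 / q)]
    rw [h2]
    gcongr
  have hratio : ∀ᶠ k : ℕ in atTop, Real.exp 1 * ((k : ℝ) + 1) ≤ 1 + 2 * μ * lam (k + 2) := by
    have hlim := (tendsto_pow_const_div_const_pow_of_one_lt 1 hb1)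
    have hlim' := (tendsto_add_atTop_iff_nat 1).2 hlim
    have hpos : 0 < 2 * μ * D / Real.exp 1 := by positivity
    filter_upwards [hlim'.eventually_lt_const hpos] with k hk
    rw [pow_one, div_lt_div_iff₀ (by positivity) (by positivity)] at hk
    push_cast at hk
    have h3 := mul_le_mul_of_nonneg_left (hgeom (k + 1)) (by positivity : 0 ≤ 2 * μ)
    linarith
  obtain ⟨K, hK⟩ := eventually_atTop.1 hratio
  -- From `K` on, `A (k + 1)` grows at least as fast as `exp k * k!`.
  set c := A (K + 1) / (Real.exp 1 ^ K * (K.factorial : ℝ)) with hc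
  have hAK := hA K
  have hc0 : 0 < c := by positivity
  refine ⟨c, hc0, ?_⟩
  have hfact : ∀ k ≥ K, c * (Real.exp 1 ^ k * (k.factorial : ℝ)) ≤ A (k + 1) := by
    intro k hk
    induction k, hk using Nat.le_induction with
    | base => rw [hc, div_mul_cancel₀ _ (by positivity)]
    | succ k hk ih =>
      calc c * (Real.exp 1 ^ (k + 1) * ((k + 1).factorial : ℝ))
          = Real.exp 1 * ((k : ℝ) + 1) * (c * (Real.exp 1 ^ k * (k.factorial : ℝ))) := by
            rw [Nat.factorial_succ]; push_cast; ring
        _ ≤ (1 + 2 * μ * lam (k + 2)) * A (k + 1) := by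
            have h5 := hK k hk
            have h6 : 0 ≤ 1 + 2 * μ * lam (k + 2) := le_trans (by positivity) h5
            gcongr
        _ ≤ _ := hrec k
  filter_upwards [eventually_ge_atTop K] with k hk
  refine le_trans ?_ (hfact k hk)
  have h4 := Real.pow_div_factorial_le_exp (k : ℝ) k.cast_nonneg k
  rw [div_le_iff₀ (by positivity)] at h4
  rw [← Real.exp_nat_mul, mul_one]
  gcongr

/-- The exponent `k (p - 1) / (p + 1)` of the rate is at most `k`. -/
theorem isBigO_inv_aggregated {p : ℕ} (hp : 1 ≤ p) {c : ℝ} (hc : 0 < c)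
    (hA : ∀ᶠ k : ℕ in atTop, c * (k : ℝ) ^ k ≤ A (k + 1)) :
    (fun k : ℕ => 1 / A (k + 1)) =O[atTop] fun k : ℕ => superRate p k := by
  refine IsBigO.of_bound (1 / c) ?_
  filter_upwards [hA, eventually_ge_atTop 1] with k hk hk1
  have hk1' : (1 : ℝ) ≤ k := by exact_mod_cast hk1
  have hk0 : (0 : ℝ) < k := by linarith
  have hp' : (1 : ℝ) ≤ p := by exact_mod_cast hp
  have hApos : 0 < A (k + 1) := lt_of_lt_of_le (by positivity) hk
  unfold superRate
  rw [Real.norm_of_nonneg (by positivity), Real.norm_of_nonneg (by positivity), one_div_mul_one_div]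
  refine one_div_le_one_div_of_le (by positivity) (le_trans ?_ hk)
  rw [← Real.rpow_natCast]
  refine mul_le_mul_of_nonneg_left (Real.rpow_le_rpow_of_exponent_le hk1' ?_) hc.le
  refine mul_le_of_le_one_right hk0.le ?_
  rw [div_le_one (by linarith)]
  linarith

end Growth

/-! ### The composite problem -/

theorem ne_top_of_mem_epsSubdiff {f : H → EReal} (hf : IsProper f) {ε : ℝ} {y u : H}
    (hu : u ∈ epsSubdiff f ε y) : f y ≠ ⊤ := by
  obtain ⟨w, hw⟩ := hf.2
  intro h
  have := hu w
  rw [h, EReal.top_add_of_ne_bot (EReal.coe_ne_bot _), top_le_iff] at this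
  exact hw this

namespace IsTensorProblem

variable {f g : H → EReal} {Ω : Set H} {μ : ℝ} {p : ℕ} {L : ℝ}

theorem mu_pos (h : IsTensorProblem f g Ω μ p L) : 0 < μ := h.strong_g.1

theorem stronglyConvexOnDom_g (h : IsTensorProblem f g Ω μ p L) : StronglyConvexOnDom μ g :=
  h.strong_g.stronglyConvexOnDom h.proper_g.1

theorem stronglyConvexOnDom_sum (h : IsTensorProblem f g Ω μ p L) :
    StronglyConvexOnDom μ (fun x => f x + g x) := by
  have := (h.convex_f.stronglyConvexOnDom h.proper_f.1).add h.stronglyConvexOnDom_g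
    h.proper_f.1 h.proper_g.1
  rwa [zero_add] at this

theorem sum_ne_bot (h : IsTensorProblem f g Ω μ p L) (x : H) : f x + g x ≠ ⊥ := by
  rw [Ne, EReal.add_eq_bot_iff, not_or]
  exact ⟨h.proper_f.1 x, h.proper_g.1 x⟩

theorem sum_ne_top_iff (h : IsTensorProblem f g Ω μ p L) {x : H} :
    f x + g x ≠ ⊤ ↔ f x ≠ ⊤ ∧ g x ≠ ⊤ :=
  ⟨fun hx => ⟨fun e => hx (by rw [e, EReal.top_add_of_ne_bot (h.proper_g.1 x)]),
    fun e => hx (by rw [e, EReal.add_top_of_ne_bot (h.proper_f.1 x)])⟩,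
    fun hx => EReal.add_ne_top hx.1 hx.2⟩

theorem solution_ne_top (h : IsTensorProblem f g Ω μ p L) {xs : H} (hxs : IsSolution f g xs) :
    f xs + g xs ≠ ⊤ := by
  obtain ⟨w, hw⟩ := h.dom_sum
  exact ne_top_of_le_ne_top hw (hxs w)

theorem existsUnique_solution [FiniteDimensional ℝ H] (h : IsTensorProblem f g Ω μ p L) :
    ∃! xs, IsSolution f g xs := by
  obtain ⟨x₀, hx₀⟩ := h.dom_sum
  obtain ⟨xs, hxs⟩ := h.stronglyConvexOnDom_sum.exists_isMin h.mu_pos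
    (lowerSemicontinuous_add_of_ne_bot h.closed_f h.closed_g h.proper_f.1 h.proper_g.1)
    h.sum_ne_bot hx₀
  refine ⟨xs, hxs, fun ys hys => ?_⟩
  have h1 := h.stronglyConvexOnDom_sum.growth_of_isMin h.sum_ne_bot hxs (h.solution_ne_top hys)
  have h2 := EReal.toReal_le_toReal (hys xs) (h.sum_ne_bot ys) (h.solution_ne_top hxs)
  have h3 : ‖ys - xs‖ ^ 2 ≤ 0 := by
    have hμ := h.mu_pos
    have : μ / 2 * ‖ys - xs‖ ^ 2 ≤ 0 := by linarith
    exact nonpos_of_mul_nonpos_right this (by positivity)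
  have h4 : ‖ys - xs‖ = 0 := pow_eq_zero_iff (two_ne_zero) |>.1 (le_antisymm h3 (by positivity))
  exact sub_eq_zero.1 (norm_eq_zero.1 h4)

theorem dom_f_subset [FiniteDimensional ℝ H] (h : IsTensorProblem f g Ω μ p L) {x : H}
    (hx : f x ≠ ⊤) : x ∈ Ω :=
  closure_minimal h.dom_subset h.closed_dom
    (mem_closure_domSubdiff h.convex_f h.closed_f h.proper_f.1 hx)

theorem g_ne_top (h : IsTensorProblem f g Ω μ p L) {x : H} (hx : x ∈ Ω) : g x ≠ ⊤ :=
  (h.smooth_g x hx).1.self_of_nhds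

theorem differentiableAt_realPart (h : IsTensorProblem f g Ω μ p L) {x : H} (hx : x ∈ Ω) :
    DifferentiableAt ℝ (realPart g) x := by
  refine (h.smooth_g x hx).2.differentiableAt ?_
  have := h.two_le
  exact_mod_cast (by omega : p ≠ 0)

theorem gradient_mem_subdiff [CompleteSpace H] (h : IsTensorProblem f g Ω μ p L) {y : H}
    (hy : y ∈ Ω) : gradient (realPart g) y ∈ subdiff g y := by
  intro w
  by_cases hw : g w = ⊤
  · rw [hw]; exact le_top
  have h1 := h.stronglyConvexOnDom_g.gradient_inequality h.proper_g.1 (h.g_ne_top hy)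
    (h.differentiableAt_realPart hy) hw
  have hμ := h.mu_pos
  have h2 : 0 ≤ μ / 2 * ‖w - y‖ ^ 2 := by positivity
  rw [← EReal.coe_toReal (h.g_ne_top hy) (h.proper_g.1 y), ← EReal.coe_toReal hw (h.proper_g.1 w)]
  norm_cast
  linarith

/-- The quadratic lower model of the objective at `y` generated by an `ε`-subgradient of `f` and
the gradient of `g`. -/
theorem model_le [CompleteSpace H] (h : IsTensorProblem f g Ω μ p L) {y u w : H} {ε : ℝ}
    (hy : y ∈ Ω) (hu : u ∈ epsSubdiff f ε y) (hw : f w + g w ≠ ⊤) :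
    (f y + g y).toReal + inner ℝ (u + gradient (realPart g) y) (w - y) + μ / 2 * ‖w - y‖ ^ 2 - ε ≤
      (f w + g w).toReal := by
  obtain ⟨hfw, hgw⟩ := h.sum_ne_top_iff.1 hw
  have hfy := ne_top_of_mem_epsSubdiff h.proper_f hu
  have hgy := h.g_ne_top hy
  have h1 := h.stronglyConvexOnDom_g.gradient_inequality h.proper_g.1 hgy
    (h.differentiableAt_realPart hy) hgw
  have h2 := hu w
  rw [← EReal.coe_toReal hfy (h.proper_f.1 y), ← EReal.coe_toReal hfw (h.proper_f.1 w)] at h2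
  norm_cast at h2
  rw [EReal.toReal_add hfy (h.proper_f.1 y) hgy (h.proper_g.1 y),
    EReal.toReal_add hfw (h.proper_f.1 w) hgw (h.proper_g.1 w), inner_add_left]
  linarith

end IsTensorProblem

/-! ### Analysis of a run -/

namespace IsTensorRun

variable [CompleteSpace H] {f g : H → EReal} {Ω : Set H} {μ : ℝ} {p : ℕ} {L M σhat σl σu : ℝ}
  {x y xt u v : ℕ → H} {lam a A ε : ℕ → ℝ}

theorem y_mem [FiniteDimensional ℝ H] (hprob : IsTensorProblem f g Ω μ p L)
    (hrun : IsTensorRun f g Ω μ p L M σhat σl σu x y xt u v lam a A ε) (k : ℕ) :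
    y (k + 1) ∈ Ω :=
  hprob.dom_f_subset (ne_top_of_mem_epsSubdiff hprob.proper_f (hrun.approx k).2.2.2.1)

theorem obj_ne_top [FiniteDimensional ℝ H] (hprob : IsTensorProblem f g Ω μ p L)
    (hrun : IsTensorRun f g Ω μ p L M σhat σl σu x y xt u v lam a A ε) (k : ℕ) :
    f (y (k + 1)) + g (y (k + 1)) ≠ ⊤ :=
  EReal.add_ne_top (ne_top_of_mem_epsSubdiff hprob.proper_f (hrun.approx k).2.2.2.1)
    (hprob.g_ne_top (hrun.y_mem hprob k))

/-- Every approximate tensor solution whose step size obeys the upper large-step bound satisfies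
the relative-error criterion for the exact objective, with parameter `σu + σhat`. -/
theorem residual [FiniteDimensional ℝ H] (hprob : IsTensorProblem f g Ω μ p L) (hM : 0 < M)
    (hrun : IsTensorRun f g Ω μ p L M σhat σl σu x y xt u v lam a A ε) (k : ℕ) :
    ‖lam (k + 1) • v (k + 1) + y (k + 1) - xt k‖ ^ 2 / (1 + lam (k + 1) * μ)
        + 2 * lam (k + 1) * ε (k + 1) ≤ (σu + σhat) ^ 2 * ‖y (k + 1) - xt k‖ ^ 2 := by
  obtain ⟨-, hlam, hε, -, z, hz, hres⟩ := hrun.approx k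
  have hμ := hprob.mu_pos
  have hL := hprob.L_pos
  have hp := hprob.two_le
  have hσu : 0 < σu := hrun.σl_pos.trans hrun.σl_lt
  have hy := hrun.y_mem hprob k
  have hgrad := norm_gradient_tensorModel_sub_le hprob.convex_dom (by omega) hM.le hprob.smooth_g
    hprob.lipschitz hz.1 hy
  have hproj := hz.norm_sub_le hprob.convex_dom hy
  have he : ‖lam (k + 1) • (gradient (realPart g) (y (k + 1))
      - gradient (tensorModel g p M z) (y (k + 1)))‖ ≤
        σu * √(1 + lam (k + 1) * μ) * ‖y (k + 1) - xt k‖ := by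
    rw [norm_smul, Real.norm_of_nonneg hlam.le]
    have hup := hrun.step_upper k
    rw [le_div_iff₀ (by positivity)] at hup
    have hfac : (0 : ℝ) < p.factorial := by positivity
    have hpow : ‖y (k + 1) - xt k‖ ^ p = ‖y (k + 1) - xt k‖ ^ (p - 1) * ‖y (k + 1) - xt k‖ := by
      rw [← pow_succ, Nat.sub_add_cancel (by omega)]
    calc _ ≤ lam (k + 1) * ((L + M) / (p.factorial : ℝ) * ‖y (k + 1) - xt k‖ ^ p) := by
          gcongr
          exact hgrad.trans (by gcongr)
      _ = lam (k + 1) * ‖y (k + 1) - xt k‖ ^ (p - 1) * (L + M) / (p.factorial : ℝ)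
            * ‖y (k + 1) - xt k‖ := by rw [hpow]; ring
      _ ≤ (p.factorial : ℝ) * σu * √(1 + lam (k + 1) * μ) / (p.factorial : ℝ)
            * ‖y (k + 1) - xt k‖ := by gcongr
      _ = _ := by field_simp
  have h := residual_of_model_residual hlam hμ hε hrun.σhat_nonneg (norm_nonneg _) hσu.le hres he
  have e : lam (k + 1) • (u (k + 1) + gradient (tensorModel g p M z) (y (k + 1)))
      + y (k + 1) - xt k + lam (k + 1) • (gradient (realPart g) (y (k + 1))
        - gradient (tensorModel g p M z) (y (k + 1))) =
      lam (k + 1) • v (k + 1) + y (k + 1) - xt k := by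
    rw [hrun.v_eq k]; module
  rwa [e] at h

theorem A_nonneg (hμ : 0 < μ) (hrun : IsTensorRun f g Ω μ p L M σhat σl σu x y xt u v lam a A ε)
    (k : ℕ) : 0 ≤ A k := by
  induction k with
  | zero => rw [hrun.A_zero]
  | succ k ih =>
    have h := (step_size_facts hμ ih (hrun.lam_pos k) (hrun.a_eq k)).2
    have := hrun.lam_pos k
    have h2 : 0 ≤ (1 + 2 * μ * A k) * lam (k + 1) := by positivity
    rw [hrun.A_eq k]
    linarith

theorem A_one (hμ : 0 < μ)
    (hrun : IsTensorRun f g Ω μ p L M σhat σl σu x y xt u v lam a A ε) : A 1 = lam 1 := by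
  have hl := hrun.lam_pos 0
  obtain ⟨h1, h2⟩ := step_size_facts hμ (hrun.A_nonneg hμ 0) hl (hrun.a_eq 0)
  rw [hrun.A_zero] at h1 h2
  simp only [zero_add, mul_zero, add_zero, one_mul, zero_mul] at h1 h2 hl
  have h3 : a 1 * (a 1 - lam 1) = 0 := by linear_combination h1
  have h4 := hrun.A_eq 0
  rw [hrun.A_zero, zero_add, zero_add] at h4
  rcases mul_eq_zero.1 h3 with h | h
  · linarith
  · linarith

theorem A_rec (hμ : 0 < μ) (hrun : IsTensorRun f g Ω μ p L M σhat σl σu x y xt u v lam a A ε)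
    (k : ℕ) : (1 + 2 * μ * lam (k + 1)) * A k ≤ A (k + 1) := by
  have h := (step_size_facts hμ (hrun.A_nonneg hμ k) (hrun.lam_pos k) (hrun.a_eq k)).2
  have := hrun.lam_pos k
  rw [hrun.A_eq k]
  linarith

/-- The energy estimate for a whole run. -/
theorem energy [FiniteDimensional ℝ H] (hprob : IsTensorProblem f g Ω μ p L) (hM : 0 < M)
    (hrun : IsTensorRun f g Ω μ p L M σhat σl σu x y xt u v lam a A ε) {xs : H}
    (hxs : IsSolution f g xs) (k : ℕ) :
    A k * ((f (y k) + g (y k)).toReal - (f xs + g xs).toReal) + (1 + μ * A k) / 2 * ‖xs - x k‖ ^ 2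
      + (1 - (σu + σhat) ^ 2) / 2 * ∑ j ∈ Finset.range k,
          A (j + 1) / lam (j + 1) * ‖y (j + 1) - xt j‖ ^ 2 ≤ 1 / 2 * ‖xs - x 0‖ ^ 2 := by
  have hμ := hprob.mu_pos
  induction k with
  | zero => simp [hrun.A_zero]
  | succ k ih =>
    obtain ⟨ha, hal⟩ := step_size_facts hμ (hrun.A_nonneg hμ k) (hrun.lam_pos k) (hrun.a_eq k)
    have hmodel : ∀ w, f w + g w ≠ ⊤ → (f (y (k + 1)) + g (y (k + 1))).toReal
        + inner ℝ (v (k + 1)) (w - y (k + 1)) + μ / 2 * ‖w - y (k + 1)‖ ^ 2 - ε (k + 1) ≤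
          (f w + g w).toReal := by
      intro w hw
      rw [hrun.v_eq k]
      exact hprob.model_le (hrun.y_mem hprob k) (hrun.approx k).2.2.2.1 hw
    -- The point `y 0` need not lie in the domain of the objective, but `A 0 = 0`.
    have hmodel_y : A k * ((f (y (k + 1)) + g (y (k + 1))).toReal
        + inner ℝ (v (k + 1)) (y k - y (k + 1)) + μ / 2 * ‖y k - y (k + 1)‖ ^ 2 - ε (k + 1)) ≤
          A k * (f (y k) + g (y k)).toReal := by
      cases k with
      | zero => rw [hrun.A_zero, zero_mul, zero_mul]
      | succ k =>
        exact mul_le_mul_of_nonneg_left (hmodel _ (hrun.obj_ne_top hprob k)) (hrun.A_nonneg hμ _)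
    have hx' := hrun.x_eq k
    rw [hrun.A_eq k] at hx'
    have hstep := energy_step hμ (hrun.A_nonneg hμ k) (hrun.lam_pos k) ha hal (hrun.xt_eq k) hx'
      (hrun.residual hprob hM k) hmodel_y (hmodel xs (hprob.solution_ne_top hxs))
    rw [← hrun.A_eq k] at hstep
    rw [Finset.sum_range_succ, mul_add]
    linarith

theorem objective_gap_nonneg [FiniteDimensional ℝ H] (hprob : IsTensorProblem f g Ω μ p L)
    (hrun : IsTensorRun f g Ω μ p L M σhat σl σu x y xt u v lam a A ε) {xs : H}
    (hxs : IsSolution f g xs) (k : ℕ) :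
    μ / 2 * ‖xs - y (k + 1)‖ ^ 2 ≤
      (f (y (k + 1)) + g (y (k + 1))).toReal - (f xs + g xs).toReal := by
  have := hprob.stronglyConvexOnDom_sum.growth_of_isMin hprob.sum_ne_bot hxs
    (hrun.obj_ne_top hprob k)
  rw [norm_sub_rev]
  linarith

theorem sum_le [FiniteDimensional ℝ H] (hprob : IsTensorProblem f g Ω μ p L) (hM : 0 < M)
    (hrun : IsTensorRun f g Ω μ p L M σhat σl σu x y xt u v lam a A ε) {xs : H}
    (hxs : IsSolution f g xs) (k : ℕ) :
    (1 - (σu + σhat) ^ 2) * ∑ j ∈ Finset.range k,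
          A (j + 1) / lam (j + 1) * ‖y (j + 1) - xt j‖ ^ 2 ≤ ‖xs - x 0‖ ^ 2 := by
  have hμ := hprob.mu_pos
  have h := hrun.energy hprob hM hxs k
  have hA := hrun.A_nonneg hμ k
  have h1 : 0 ≤ A k * ((f (y k) + g (y k)).toReal - (f xs + g xs).toReal) := by
    cases k with
    | zero => rw [hrun.A_zero, zero_mul]
    | succ k => exact mul_nonneg hA
                  (le_trans (by positivity) (hrun.objective_gap_nonneg hprob hxs k))
  have h2 : 0 ≤ (1 + μ * A k) / 2 * ‖xs - x k‖ ^ 2 := by positivity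
  linarith

theorem A_pos (hμ : 0 < μ) (hrun : IsTensorRun f g Ω μ p L M σhat σl σu x y xt u v lam a A ε)
    (k : ℕ) : 0 < A (k + 1) :=
  lt_of_lt_of_le (hrun.lam_pos 0)
    (lam_one_le_aggregated hμ hrun.lam_pos (hrun.A_one hμ) (fun k => hrun.A_rec hμ (k + 1)) k)

/-- Function values and errors are controlled by the aggregated step size. -/
theorem objective_gap_le [FiniteDimensional ℝ H] (hprob : IsTensorProblem f g Ω μ p L) (hM : 0 < M)
    (hrun : IsTensorRun f g Ω μ p L M σhat σl σu x y xt u v lam a A ε) {xs : H}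
    (hxs : IsSolution f g xs) (k : ℕ) :
    (f (y (k + 1)) + g (y (k + 1))).toReal - (f xs + g xs).toReal ≤
      ‖xs - x 0‖ ^ 2 / 2 * (1 / A (k + 1)) ∧
    max (‖xs - x (k + 1)‖ ^ 2) (‖xs - y (k + 1)‖ ^ 2) ≤
      ‖xs - x 0‖ ^ 2 / μ * (1 / A (k + 1)) := by
  have hμ := hprob.mu_pos
  have hA := hrun.A_pos hμ k
  have h := hrun.energy hprob hM hxs (k + 1)
  have hgap := hrun.objective_gap_nonneg hprob hxs k
  have hgap0 := le_trans (by positivity) hgap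
  have hσ : (σu + σhat) ^ 2 ≤ 1 := by
    have h1 := hrun.σ_lt
    have h2 := hrun.σhat_nonneg
    have h3 := hrun.σl_pos.trans hrun.σl_lt
    exact pow_le_one₀ (by linarith) h1.le
  have hsum : 0 ≤ (1 - (σu + σhat) ^ 2) / 2 * ∑ j ∈ Finset.range (k + 1),
      A (j + 1) / lam (j + 1) * ‖y (j + 1) - xt j‖ ^ 2 := by
    refine mul_nonneg (by linarith) (Finset.sum_nonneg fun j _ => ?_)
    have := hrun.A_pos hμ j
    have := hrun.lam_pos j
    positivity
  have h1 : 0 ≤ A (k + 1) * ((f (y (k + 1)) + g (y (k + 1))).toReal - (f xs + g xs).toReal) :=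
    mul_nonneg hA.le hgap0
  have hx0 : 0 ≤ ‖xs - x (k + 1)‖ ^ 2 := by positivity
  have hx1 : 0 ≤ μ * A (k + 1) * ‖xs - x (k + 1)‖ ^ 2 := by positivity
  have hmain : (f (y (k + 1)) + g (y (k + 1))).toReal - (f xs + g xs).toReal ≤
      ‖xs - x 0‖ ^ 2 / 2 * (1 / A (k + 1)) := by
    rw [mul_one_div, le_div_iff₀ hA]
    linarith
  refine ⟨hmain, max_le ?_ ?_⟩
  · rw [div_mul_div_comm, mul_one, le_div_iff₀ (by positivity)]
    linarith
  · have h2 := hgap.trans hmain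
    rw [mul_one_div, div_div, le_div_iff₀ (by positivity)] at h2
    rw [mul_one_div, div_div, le_div_iff₀ (by positivity)]
    linarith

/-- The displacement of a step is controlled by the errors of the points it involves, since the
extrapolated point is a convex combination of `x k` and `y k`. -/
theorem displacement_le [FiniteDimensional ℝ H] (hprob : IsTensorProblem f g Ω μ p L) (hM : 0 < M)
    (hrun : IsTensorRun f g Ω μ p L M σhat σl σu x y xt u v lam a A ε) {xs : H}
    (hxs : IsSolution f g xs) (k : ℕ) :
    ‖y (k + 2) - xt (k + 1)‖ ^ 2 ≤ 4 * (‖xs - x 0‖ ^ 2 / μ * (1 / A (k + 1))) := by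
  have hμ := hprob.mu_pos
  have hA := hrun.A_pos hμ k
  have hl := hrun.lam_pos (k + 1)
  obtain ⟨ha, hal⟩ := step_size_facts hμ hA.le hl (hrun.a_eq (k + 1))
  have hAle : A (k + 1) ≤ A (k + 2) := by
    have h1 := hrun.A_rec hμ (k + 1)
    have h2 : 0 ≤ 2 * μ * lam (k + 2) * A (k + 1) := by positivity
    linarith
  set B := ‖xs - x 0‖ ^ 2 / μ * (1 / A (k + 1)) with hB
  have hxy := (hrun.objective_gap_le hprob hM hxs k).2
  have hy' : ‖xs - y (k + 2)‖ ^ 2 ≤ B := by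
    refine (le_max_right _ _).trans ((hrun.objective_gap_le hprob hM hxs (k + 1)).2.trans ?_)
    rw [hB]
    gcongr
  have hxB : ‖xs - x (k + 1)‖ ^ 2 ≤ B := (le_max_left _ _).trans hxy
  have hyB : ‖xs - y (k + 1)‖ ^ 2 ≤ B := (le_max_right _ _).trans hxy
  have ha0 : 0 < a (k + 2) := lt_of_lt_of_le (by positivity) hal
  set t := (a (k + 2) - μ * A (k + 1) * lam (k + 2)) / (A (k + 1) + a (k + 2)) with ht
  have ht0 : 0 ≤ t := by
    have h2 : 0 ≤ μ * A (k + 1) * lam (k + 2) := by positivity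
    refine div_nonneg ?_ (by positivity)
    linarith
  have ht1 : 1 - t = (A (k + 1) + μ * A (k + 1) * lam (k + 2)) / (A (k + 1) + a (k + 2)) := by
    rw [ht]; field_simp; ring
  have ht1' : 0 ≤ 1 - t := by rw [ht1]; positivity
  have hxt := hrun.xt_eq (k + 1)
  rw [← ht, ← ht1] at hxt
  have hxtB : ‖xt (k + 1) - xs‖ ^ 2 ≤ B := by
    rw [hxt, norm_sub_sq_convexComb, norm_sub_rev _ xs, norm_sub_rev _ xs]
    have h1 := mul_le_mul_of_nonneg_left hxB ht0
    have h2 := mul_le_mul_of_nonneg_left hyB ht1'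
    have h3 : 0 ≤ t * (1 - t) * ‖x (k + 1) - y (k + 1)‖ ^ 2 := by positivity
    linarith
  have hpar := parallelogram_law_with_norm ℝ (y (k + 2) - xs) (xt (k + 1) - xs)
  rw [sub_sub_sub_cancel_right, norm_sub_rev (y (k + 2)) xs] at hpar
  nlinarith [mul_self_nonneg ‖y (k + 2) - xs + (xt (k + 1) - xs)‖]

end IsTensorRun

/-! ### The rate constant -/

/-- The defining property of the rate constant `D = C / d₀^(2(p-1)/(p+1))`: its power with exponent
`(p+1)/(p-1)` is the coefficient of the summability estimate for the step sizes. -/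
theorem rate_constant_rpow {P l θ τ d : ℝ} (hP : 1 < P) (hl : 0 < l) (hθ : 0 < θ) (hτ : 0 < τ)
    (hd : 0 < d) :
    (l ^ ((P - 1) / (P + 1)) * θ ^ (2 / (P + 1)) * τ ^ ((P - 1) / (P + 1))
        / d ^ (2 * (P - 1) / (P + 1))) ^ ((P + 1) / (P - 1)) =
      l * θ ^ (2 / (P - 1)) * τ / d ^ 2 := by
  have h1 : P - 1 ≠ 0 := by linarith
  have h2 : P + 1 ≠ 0 := by linarith
  rw [Real.div_rpow (by positivity) (by positivity), Real.mul_rpow (by positivity) (by positivity),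
    Real.mul_rpow (by positivity) (by positivity), ← Real.rpow_mul hl.le, ← Real.rpow_mul hθ.le,
    ← Real.rpow_mul hτ.le, ← Real.rpow_mul hd.le]
  have e1 : (P - 1) / (P + 1) * ((P + 1) / (P - 1)) = 1 := by field_simp
  have e2 : 2 / (P + 1) * ((P + 1) / (P - 1)) = 2 / (P - 1) := by field_simp
  have e3 : 2 * (P - 1) / (P + 1) * ((P + 1) / (P - 1)) = 2 := by field_simp
  rw [e1, e2, e3, Real.rpow_one, Real.rpow_one, Real.rpow_two]

/-- A lower large-step bound turns a power of the step size into a squared displacement. -/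
theorem rpow_div_step_le {P θ l ρ : ℝ} {p : ℕ} (hP : P = p) (hp : 2 ≤ p) (hθ : 0 < θ) (hl : 0 < l)
    (hρ : 0 ≤ ρ) (hstep : θ ≤ l * ρ ^ (p - 1)) :
    θ ^ (2 / (P - 1)) / l ^ ((P + 1) / (P - 1)) ≤ 1 / l * ρ ^ 2 := by
  have hP2 : (2 : ℝ) ≤ P := by rw [hP]; exact_mod_cast hp
  have hP1 : 0 < P - 1 := by linarith
  have e1 : (P + 1) / (P - 1) = 1 + 2 / (P - 1) := by field_simp; ring
  rw [e1, Real.rpow_add hl, Real.rpow_one, one_div_mul_eq_div, mul_comm l, ← div_div,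
    ← Real.div_rpow hθ.le hl.le]
  gcongr
  have h1 : θ / l ≤ ρ ^ (P - 1) := by
    rw [div_le_iff₀ hl, mul_comm, hP]
    have e2 : (p : ℝ) - 1 = ((p - 1 : ℕ) : ℝ) := by
      push_cast [Nat.cast_sub (by omega : 1 ≤ p)]; rfl
    rwa [e2, Real.rpow_natCast]
  calc (θ / l) ^ (2 / (P - 1)) ≤ (ρ ^ (P - 1)) ^ (2 / (P - 1)) := by gcongr
    _ = ρ ^ 2 := by
      rw [← Real.rpow_mul hρ, mul_div_cancel₀ _ hP1.ne', Real.rpow_two]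

namespace IsTensorRun

variable [CompleteSpace H]
  {f g : H → EReal} {Ω : Set H} {μ : ℝ} {p : ℕ} {L M σhat σl σu : ℝ}
  {x y xt u v : ℕ → H} {lam a A ε : ℕ → ℝ}

theorem theta_pos (hprob : IsTensorProblem f g Ω μ p L) (hM : 0 < M)
    (hrun : IsTensorRun f g Ω μ p L M σhat σl σu x y xt u v lam a A ε) :
    0 < (p.factorial : ℝ) * σl / (L + M) := by
  have := hprob.L_pos
  have := hrun.σl_pos
  positivity

theorem one_sub_sq_pos (hrun : IsTensorRun f g Ω μ p L M σhat σl σu x y xt u v lam a A ε) :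
    0 < 1 - (σu + σhat) ^ 2 := by
  have h1 := hrun.σ_lt
  have h2 := hrun.σhat_nonneg
  have h3 := hrun.σl_pos.trans hrun.σl_lt
  nlinarith

/-- The starting point is not the solution: otherwise the energy estimate would force the first
displacement to vanish, against the lower large-step bound. -/
theorem dist_pos [FiniteDimensional ℝ H] (hprob : IsTensorProblem f g Ω μ p L) (hM : 0 < M)
    (hrun : IsTensorRun f g Ω μ p L M σhat σl σu x y xt u v lam a A ε) {xs : H}
    (hxs : IsSolution f g xs) : 0 < ‖x 0 - xs‖ := by
  have hθ := hrun.theta_pos hprob hM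
  have hl := hrun.lam_pos 0
  have hp := hprob.two_le
  have hτ := hrun.one_sub_sq_pos
  have hdisp : y (0 + 1) - xt 0 ≠ 0 := by
    intro h
    have := hrun.step_lower 0
    rw [h, norm_zero, zero_pow (by omega), mul_zero] at this
    linarith
  have hA := hrun.A_pos hprob.mu_pos 0
  have h := hrun.sum_le hprob hM hxs 1
  rw [Finset.sum_range_one, norm_sub_rev xs] at h
  have h1 : 0 < (1 - (σu + σhat) ^ 2) *
      (A (0 + 1) / lam (0 + 1) * ‖y (0 + 1) - xt 0‖ ^ 2) := by
    have := norm_pos_iff.2 hdisp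
    positivity
  exact lt_of_pow_lt_pow_left₀ 2 (norm_nonneg _) (by rw [zero_pow two_ne_zero]; linarith)

/-- The summability of the powers of the step sizes, weighted by the aggregated step sizes. -/
theorem rate_sum_le [FiniteDimensional ℝ H] (hprob : IsTensorProblem f g Ω μ p L) (hM : 0 < M)
    (hrun : IsTensorRun f g Ω μ p L M σhat σl σu x y xt u v lam a A ε) {xs : H}
    (hxs : IsSolution f g xs) {θ D : ℝ} (hθ : θ = (p.factorial : ℝ) * σl / (L + M))
    (hD : D = lam 1 ^ (((p : ℝ) - 1) / ((p : ℝ) + 1)) * θ ^ (2 / ((p : ℝ) + 1))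
      * (1 - (σu + σhat) ^ 2) ^ (((p : ℝ) - 1) / ((p : ℝ) + 1))
      / ‖x 0 - xs‖ ^ (2 * ((p : ℝ) - 1) / ((p : ℝ) + 1))) (n : ℕ) :
    ∑ j ∈ Finset.range n, A (j + 1) / lam 1 *
      (D / lam (j + 1)) ^ (((p : ℝ) + 1) / ((p : ℝ) - 1)) ≤ 1 := by
  have hd := hrun.dist_pos hprob hM hxs
  have hθ0 : 0 < θ := hθ ▸ hrun.theta_pos hprob hM
  have hτ := hrun.one_sub_sq_pos
  have hl1 := hrun.lam_pos 0
  have hP : (1 : ℝ) < p := by exact_mod_cast hprob.two_le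
  have hDq := rate_constant_rpow hP hl1 hθ0 hτ hd
  rw [zero_add] at hDq hl1
  rw [← hD] at hDq
  have hD0 : 0 < D := by rw [hD]; positivity
  have hterm : ∀ j ∈ Finset.range n, A (j + 1) / lam 1 *
      (D / lam (j + 1)) ^ (((p : ℝ) + 1) / ((p : ℝ) - 1)) ≤
        (1 - (σu + σhat) ^ 2) / ‖x 0 - xs‖ ^ 2 *
          (A (j + 1) / lam (j + 1) * ‖y (j + 1) - xt j‖ ^ 2) := by
    intro j _
    have hl := hrun.lam_pos j
    have hA := hrun.A_pos hprob.mu_pos j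
    have hstep := rpow_div_step_le (P := (p : ℝ)) rfl hprob.two_le hθ0 hl
      (norm_nonneg (y (j + 1) - xt j)) (hθ ▸ hrun.step_lower j)
    rw [Real.div_rpow hD0.le hl.le, hDq]
    calc _ = (1 - (σu + σhat) ^ 2) / ‖x 0 - xs‖ ^ 2 * A (j + 1) *
          (θ ^ (2 / ((p : ℝ) - 1)) / lam (j + 1) ^ (((p : ℝ) + 1) / ((p : ℝ) - 1))) := by
          field_simp
      _ ≤ (1 - (σu + σhat) ^ 2) / ‖x 0 - xs‖ ^ 2 * A (j + 1) *
          (1 / lam (j + 1) * ‖y (j + 1) - xt j‖ ^ 2) := by gcongr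
      _ = _ := by ring
  refine (Finset.sum_le_sum hterm).trans ?_
  rw [← Finset.mul_sum, div_mul_eq_mul_div, div_le_one (by positivity), norm_sub_rev (x 0)]
  exact hrun.sum_le hprob hM hxs n

/-- The relative-error criterion bounds the residuals by the displacement. -/
theorem residual_bounds [FiniteDimensional ℝ H] (hprob : IsTensorProblem f g Ω μ p L)
    (hM : 0 < M)
    (hrun : IsTensorRun f g Ω μ p L M σhat σl σu x y xt u v lam a A ε) {D : ℝ} (hD : 0 < D) (k : ℕ)
    (hDl : D ≤ lam (k + 1)) :
    ‖v (k + 1)‖ ^ 2 ≤ (1 + (σu + σhat) * √(1 + μ * D)) ^ 2 / D ^ 2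
        * ‖y (k + 1) - xt k‖ ^ 2 ∧
    ε (k + 1) ≤ (σu + σhat) ^ 2 / (2 * D) * ‖y (k + 1) - xt k‖ ^ 2 := by
  have hμ := hprob.mu_pos
  have hl := hrun.lam_pos k
  have hσ : 0 ≤ σu + σhat := by
    have h2 := hrun.σhat_nonneg
    have h3 := hrun.σl_pos.trans hrun.σl_lt
    linarith
  have hε : 0 ≤ ε (k + 1) := (hrun.approx k).2.2.1
  have hres := hrun.residual hprob hM k
  set σ := σu + σhat with hσdef
  set l := lam (k + 1) with hldef
  set δ := ‖y (k + 1) - xt k‖ with hδ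
  have hδ0 : 0 ≤ δ := norm_nonneg _
  have hpos : 0 < 1 + l * μ := by positivity
  constructor
  · set q := √(1 + l * μ) with hq
    have hq0 : 0 < q := Real.sqrt_pos.2 hpos
    have hq2 : 1 + l * μ = q ^ 2 := (Real.sq_sqrt hpos.le).symm
    have h1 : ‖l • v (k + 1) + y (k + 1) - xt k‖ ≤ σ * q * δ := by
      refine le_of_sq_le_sq ?_ (by positivity)
      have h2 : 0 ≤ 2 * l * ε (k + 1) := by positivity
      have h3 : ‖l • v (k + 1) + y (k + 1) - xt k‖ ^ 2 / (1 + l * μ) ≤ σ ^ 2 * δ ^ 2 := by linarith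
      rw [div_le_iff₀ hpos, hq2] at h3
      linarith
    have h2 : l * ‖v (k + 1)‖ ≤ (1 + σ * q) * δ := by
      have e : l • v (k + 1) = (l • v (k + 1) + y (k + 1) - xt k) - (y (k + 1) - xt k) := by abel
      have h3 := norm_sub_le (l • v (k + 1) + y (k + 1) - xt k) (y (k + 1) - xt k)
      rw [← e, norm_smul, Real.norm_of_nonneg hl.le] at h3
      linarith
    -- The map `l ↦ √(1 + l μ) / l` is decreasing.
    have h4 : D * q ≤ l * √(1 + μ * D) := by
      refine le_of_sq_le_sq ?_ (by positivity)
      rw [mul_pow, mul_pow, ← hq2, Real.sq_sqrt (by positivity)]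
      have h5 : D ^ 2 ≤ l ^ 2 := by gcongr
      have h6 : μ * D * l * D ≤ μ * D * l * l := by gcongr
      linarith
    have h7 : ‖v (k + 1)‖ ≤ (1 + σ * √(1 + μ * D)) / D * δ := by
      rw [div_mul_eq_mul_div, le_div_iff₀ hD]
      refine le_of_mul_le_mul_left ?_ hl
      have h8 := mul_le_mul_of_nonneg_left h2 hD.le
      have h9 := mul_le_mul_of_nonneg_left h4 (mul_nonneg hσ hδ0)
      have h10 := mul_le_mul_of_nonneg_right hDl hδ0
      linarith
    calc ‖v (k + 1)‖ ^ 2 ≤ ((1 + σ * √(1 + μ * D)) / D * δ) ^ 2 := by gcongr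
      _ = _ := by rw [mul_pow, div_pow]
  · have h1 : 0 ≤ ‖l • v (k + 1) + y (k + 1) - xt k‖ ^ 2 / (1 + l * μ) := by positivity
    rw [div_mul_eq_mul_div, le_div_iff₀ (by positivity)]
    have h2 : ε (k + 1) * (2 * D) ≤ ε (k + 1) * (2 * l) := by gcongr
    linarith

end IsTensorRun

/-- The growth factor in terms of the rate constant `D`. -/
theorem growth_eq {μ C d₀ D : ℝ} {p : ℕ}
    (hD : D = C / d₀ ^ (2 * ((p : ℝ) - 1) / ((p : ℝ) + 1))) (s : ℝ) :
    growth μ C d₀ p s = 1 + 2 * μ * D * s ^ (1 / (((p : ℝ) + 1) / ((p : ℝ) - 1))) := by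
  rw [growth, hD, one_div_div]
  ring

end TensorMethod

theorem theorem4p1 {H : Type*} [NormedAddCommGroup H] [InnerProductSpace ℝ H]
    [FiniteDimensional ℝ H] [CompleteSpace H]
    (f g : H → EReal) (Ω : Set H) (μ : ℝ) (p : ℕ) (L M : ℝ)
    (hprob : TensorMethod.IsTensorProblem f g Ω μ p L)
    (hMpos : 0 < M) (hM : (p : ℝ) * L ≤ M)
    (σhat σl σu : ℝ) (x y xt u v : ℕ → H) (lam a A ε : ℕ → ℝ)
    (hrun : TensorMethod.IsTensorRun f g Ω μ p L M σhat σl σu x y xt u v lam a A ε) :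
    (∃! xs : H, TensorMethod.IsSolution f g xs) ∧
    ∀ xs : H, TensorMethod.IsSolution f g xs →
    ∀ d₀ σ θ C : ℝ,
      d₀ = ‖x 0 - xs‖ →
      σ = σu + σhat →
      θ = (p.factorial : ℝ) * σl / (L + M) →
      C = lam 1 ^ (((p : ℝ) - 1) / ((p : ℝ) + 1)) * θ ^ (2 / ((p : ℝ) + 1))
            * (1 - σ ^ 2) ^ (((p : ℝ) - 1) / ((p : ℝ) + 1)) →
      0 < d₀ ∧
      -- bounds on function values and iterates
      (∀ k : ℕ,
        TensorMethod.objective f g (y (k + 1)) - TensorMethod.objective f g xs ≤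
            ((d₀ ^ 2 / (2 * lam 1 * TensorMethod.growth μ C d₀ p k ^ k) : ℝ) : EReal) ∧
        max (‖xs - x (k + 1)‖ ^ 2) (‖xs - y (k + 1)‖ ^ 2) ≤
            d₀ ^ 2 / (μ * lam 1 * TensorMethod.growth μ C d₀ p k ^ k)) ∧
      -- bounds on the residuals
      (∀ k : ℕ, 1 ≤ k →
        v (k + 1) ∈ TensorMethod.epsSubdiff f (ε (k + 1)) (y (k + 1))
            + TensorMethod.subdiff g (y (k + 1)) ∧
        ‖v (k + 1)‖ ^ 2 ≤
            (1 + σ * √(1 + μ * C * d₀ ^ (-(2 * ((p : ℝ) - 1) / ((p : ℝ) + 1))))) ^ 2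
              * (6 * d₀ ^ (2 * (3 * (p : ℝ) - 1) / ((p : ℝ) + 1))
                / (μ * C ^ 2 * lam 1
                    * TensorMethod.growth μ C d₀ p ((k : ℝ) - 1) ^ (k - 1))) ∧
        ε (k + 1) ≤
            3 * σ ^ 2 * d₀ ^ (4 * (p : ℝ) / ((p : ℝ) + 1))
              / (μ * C * lam 1
                  * TensorMethod.growth μ C d₀ p ((k : ℝ) - 1) ^ (k - 1))) ∧
      -- superlinear rates
      (fun k : ℕ => (TensorMethod.objective f g (y (k + 1))
          - TensorMethod.objective f g xs).toReal)
        =O[atTop] (fun k : ℕ => TensorMethod.superRate p k) ∧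
      (fun k : ℕ => max (‖xs - x (k + 1)‖ ^ 2) (‖xs - y (k + 1)‖ ^ 2))
        =O[atTop] (fun k : ℕ => TensorMethod.superRate p k) ∧
      (fun k : ℕ => ‖v (k + 1)‖ ^ 2)
        =O[atTop] (fun k : ℕ => TensorMethod.superRate p ((k : ℝ) - 1)) ∧
      (fun k : ℕ => ε (k + 1))
        =O[atTop] (fun k : ℕ => TensorMethod.superRate p ((k : ℝ) - 1)) := by
  have hμ := hprob.mu_pos
  refine ⟨hprob.existsUnique_solution, ?_⟩
  intro xs hxs d₀ σ θ C hd₀ hσ hθ hC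
  have hd : 0 < d₀ := hd₀ ▸ hrun.dist_pos hprob hMpos hxs
  have hθ0 : 0 < θ := hθ ▸ hrun.theta_pos hprob hMpos
  have hτ : 0 < 1 - σ ^ 2 := hσ ▸ hrun.one_sub_sq_pos
  have hl1 : 0 < lam 1 := hrun.lam_pos 0
  have hp2 := hprob.two_le
  have hP : (2 : ℝ) ≤ p := by exact_mod_cast hp2
  have hC0 : 0 < C := by rw [hC]; positivity
  obtain ⟨E, hE⟩ : ∃ E, E = d₀ ^ (2 * ((p : ℝ) - 1) / ((p : ℝ) + 1)) := ⟨_, rfl⟩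
  have hE0 : 0 < E := by rw [hE]; positivity
  obtain ⟨D, hD⟩ : ∃ D, D = C / d₀ ^ (2 * ((p : ℝ) - 1) / ((p : ℝ) + 1)) := ⟨_, rfl⟩
  have hDE : D = C / E := by rw [hD, hE]
  have hD0 : 0 < D := by rw [hDE]; positivity
  have hq : 0 < ((p : ℝ) + 1) / ((p : ℝ) - 1) := div_pos (by linarith) (by linarith)
  have hA1 := hrun.A_one hμ
  have hrec := fun k => hrun.A_rec hμ (k + 1)
  have hsum := hrun.rate_sum_le hprob hMpos hxs hθ (D := D) (by rw [hD, hC, hσ, hd₀])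
  have hgrow : ∀ k : ℕ, lam 1 * TensorMethod.growth μ C d₀ p k ^ k ≤ A (k + 1) := fun k => by
    rw [TensorMethod.growth_eq hD]
    exact TensorMethod.growth_le_aggregated hμ hD0 hq hrun.lam_pos hA1 hrec hsum k
  have hgpos : ∀ k : ℕ, 0 < TensorMethod.growth μ C d₀ p k := fun k => by
    rw [TensorMethod.growth_eq hD]; positivity
  have hDl := TensorMethod.le_lam hμ hD0 hq hrun.lam_pos hA1 hrec hsum
  have hinv : ∀ k : ℕ, 1 / A (k + 1) ≤ 1 / (lam 1 * TensorMethod.growth μ C d₀ p k ^ k) := fun k =>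
    one_div_le_one_div_of_le (mul_pos hl1 (pow_pos (hgpos k) k)) (hgrow k)
  have hgap : ∀ k, (f (y (k + 1)) + g (y (k + 1))).toReal - (f xs + g xs).toReal ≤
      d₀ ^ 2 / 2 * (1 / A (k + 1)) ∧ max (‖xs - x (k + 1)‖ ^ 2) (‖xs - y (k + 1)‖ ^ 2) ≤
        d₀ ^ 2 / μ * (1 / A (k + 1)) := by
    intro k
    rw [hd₀, norm_sub_rev (x 0)]
    exact hrun.objective_gap_le hprob hMpos hxs k
  have hobj : ∀ k, TensorMethod.objective f g (y (k + 1)) - TensorMethod.objective f g xs =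
      (((f (y (k + 1)) + g (y (k + 1))).toReal - (f xs + g xs).toReal : ℝ) : EReal) := by
    intro k
    rw [TensorMethod.objective, TensorMethod.objective, EReal.coe_sub,
      EReal.coe_toReal (hrun.obj_ne_top hprob k) (hprob.sum_ne_bot _),
      EReal.coe_toReal (hprob.solution_ne_top hxs) (hprob.sum_ne_bot _)]
  have hdisp : ∀ k, ‖y (k + 2) - xt (k + 1)‖ ^ 2 ≤ 4 * (d₀ ^ 2 / μ * (1 / A (k + 1))) := by
    intro k
    rw [hd₀, norm_sub_rev (x 0)]
    exact hrun.displacement_le hprob hMpos hxs k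
  have hres : ∀ k, ‖v (k + 2)‖ ^ 2 ≤
      (1 + σ * √(1 + μ * D)) ^ 2 / D ^ 2 * (4 * (d₀ ^ 2 / μ * (1 / A (k + 1)))) ∧
      ε (k + 2) ≤ σ ^ 2 / (2 * D) * (4 * (d₀ ^ 2 / μ * (1 / A (k + 1)))) := by
    intro k
    obtain ⟨h1, h2⟩ := hrun.residual_bounds hprob hMpos hD0 (k + 1) (hDl (k + 1))
    rw [← hσ] at h1 h2
    exact ⟨h1.trans (mul_le_mul_of_nonneg_left (hdisp k) (by positivity)),
      h2.trans (mul_le_mul_of_nonneg_left (hdisp k) (by positivity))⟩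
  have hApos := hrun.A_pos hμ
  obtain ⟨c, hc, hpow⟩ :=
    TensorMethod.exists_mul_pow_self_le hμ hD0 hq hrun.lam_pos hA1 hrec hsum
  have hrate := TensorMethod.isBigO_inv_aggregated (p := p) (by omega) hc hpow
  have hshift : (fun k : ℕ => 1 / A (k - 1 + 1)) =O[atTop]
      fun k : ℕ => TensorMethod.superRate p ((k : ℝ) - 1) := by
    refine (hrate.comp_tendsto (tendsto_sub_atTop_nat 1)).trans_eventuallyEq ?_
    filter_upwards [eventually_ge_atTop 1] with k hk
    simp only [Function.comp_apply]
    rw [Nat.cast_sub hk, Nat.cast_one]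
  refine ⟨hd, fun k => ⟨?_, ?_⟩, fun k hk => ⟨?_, ?_, ?_⟩, ?_, ?_, ?_, ?_⟩
  · rw [hobj, EReal.coe_le_coe_iff]
    refine (hgap k).1.trans ?_
    calc d₀ ^ 2 / 2 * (1 / A (k + 1))
        ≤ d₀ ^ 2 / 2 * (1 / (lam 1 * TensorMethod.growth μ C d₀ p k ^ k)) := by
          gcongr ?_ * ?_
          exact hinv k
      _ = _ := by rw [div_mul_div_comm, mul_one, mul_assoc]
  · refine (hgap k).2.trans ?_
    calc d₀ ^ 2 / μ * (1 / A (k + 1))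
        ≤ d₀ ^ 2 / μ * (1 / (lam 1 * TensorMethod.growth μ C d₀ p k ^ k)) := by
          gcongr ?_ * ?_
          exact hinv k
      _ = _ := by rw [div_mul_div_comm, mul_one, mul_assoc]
  · rw [hrun.v_eq k]
    exact Set.add_mem_add (hrun.approx k).2.2.2.1
      (hprob.gradient_mem_subdiff (hrun.y_mem hprob k))
  · obtain ⟨j, rfl⟩ : ∃ j, k = j + 1 := ⟨k - 1, by omega⟩
    have e1 : ((j + 1 : ℕ) : ℝ) - 1 = j := by push_cast; ring
    have e2 : μ * C * d₀ ^ (-(2 * ((p : ℝ) - 1) / ((p : ℝ) + 1))) = μ * D := by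
      rw [Real.rpow_neg hd.le, ← hE, hDE]; ring
    have e3 : d₀ ^ (2 * (3 * (p : ℝ) - 1) / ((p : ℝ) + 1)) = d₀ ^ 2 * E ^ 2 := by
      rw [hE, ← Real.rpow_natCast d₀ 2, ← Real.rpow_natCast _ 2, ← Real.rpow_mul hd.le,
        ← Real.rpow_add hd]
      congr 1
      push_cast
      field_simp
      ring
    rw [e1, e2, e3, Nat.add_sub_cancel]
    have hg := pow_pos (hgpos j) j
    have hi := hinv j
    refine (hres j).1.trans ?_
    calc _ ≤ (1 + σ * √(1 + μ * D)) ^ 2 / D ^ 2 *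
          (6 * (d₀ ^ 2 / μ * (1 / (lam 1 * TensorMethod.growth μ C d₀ p j ^ j)))) := by
          have := hApos j
          gcongr ?_ * ?_
          gcongr
          norm_num
      _ = _ := by rw [hDE]; field_simp
  · obtain ⟨j, rfl⟩ : ∃ j, k = j + 1 := ⟨k - 1, by omega⟩
    have e1 : ((j + 1 : ℕ) : ℝ) - 1 = j := by push_cast; ring
    have e3 : d₀ ^ (4 * (p : ℝ) / ((p : ℝ) + 1)) = d₀ ^ 2 * E := by
      rw [hE, ← Real.rpow_natCast d₀ 2, ← Real.rpow_add hd]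
      congr 1
      push_cast
      field_simp
      ring
    rw [e1, e3, Nat.add_sub_cancel]
    have hg := pow_pos (hgpos j) j
    have hi := hinv j
    refine (hres j).2.trans ?_
    calc _ ≤ σ ^ 2 / (2 * D) *
          (6 * (d₀ ^ 2 / μ * (1 / (lam 1 * TensorMethod.growth μ C d₀ p j ^ j)))) := by
          have := hApos j
          gcongr ?_ * ?_
          gcongr
          norm_num
      _ = _ := by rw [hDE]; field_simp; ring
  · refine IsBigO.trans (IsBigO.of_bound (d₀ ^ 2 / 2) ?_) hrate
    refine Eventually.of_forall fun k => ?_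
    have := hApos k
    rw [hobj, EReal.toReal_coe, Real.norm_of_nonneg, Real.norm_of_nonneg (by positivity)]
    · exact (hgap k).1
    · exact le_trans (by positivity) (hrun.objective_gap_nonneg hprob hxs k)
  · refine IsBigO.trans (IsBigO.of_bound (d₀ ^ 2 / μ) ?_) hrate
    refine Eventually.of_forall fun k => ?_
    have := hApos k
    rw [Real.norm_of_nonneg (le_max_of_le_left (by positivity)),
      Real.norm_of_nonneg (by positivity)]
    exact (hgap k).2
  · refine IsBigO.trans (IsBigO.of_bound ((1 + σ * √(1 + μ * D)) ^ 2 / D ^ 2 *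
      (4 * (d₀ ^ 2 / μ))) ?_) hshift
    filter_upwards [eventually_ge_atTop 1] with k hk
    obtain ⟨j, rfl⟩ : ∃ j, k = j + 1 := ⟨k - 1, by omega⟩
    have := hApos j
    rw [Nat.add_sub_cancel, Real.norm_of_nonneg (by positivity),
      Real.norm_of_nonneg (by positivity)]
    exact (hres j).1.trans_eq (by ring)
  · refine IsBigO.trans (IsBigO.of_bound (σ ^ 2 / (2 * D) * (4 * (d₀ ^ 2 / μ))) ?_) hshift
    filter_upwards [eventually_ge_atTop 1] with k hk
    obtain ⟨j, rfl⟩ : ∃ j, k = j + 1 := ⟨k - 1, by omega⟩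
    have := hApos j
    rw [Nat.add_sub_cancel, Real.norm_of_nonneg (hrun.approx (j + 1)).2.2.1,
      Real.norm_of_nonneg (by positivity)]
    exact (hres j).2.trans_eq (by ring)
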